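/- Let $n\ge 1$ and let $\mathcal F$ be the Fourier transform on $\mathcal S'(\mathbb R^n)$ given by $\langle \mathcal F u,\varphi\rangle=\langle u,\mathcal F\varphi\rangle$, $\mathcal F\varphi(\zeta)=\int e^{-ix\cdot\zeta}\varphi(x)\,dx$. For $v\in\mathcal S'(\mathbb R^n)$ let $\mathrm{WF}(v)\subset\mathbb R^n\times S^{n-1}$ be Hörmander's wavefront set: $(x,\omega)\notin\mathrm{WF}(v)$ if and only if there are $\varphi\in C_c^\infty(\mathbb R^n)$ with $\varphi(x)\ne0$ and a neighbourhood $U$ of $\omega$ in $S^{n-1}$ such that for every $N$ there is $C$ with $|\mathcal F(\varphi v)(r\omega')|\le C(1+r)^{-N}$ for all $\omega'\in U$, $r>0$. For $u\in\mathcal S'(\mathbb R^n)$ the scattering wavefront set $\mathrm{WF}_{sc}u\subset S^{n-1}\times\mathbb R^n$ is defined by $$(\theta,\xi)\in\mathrm{WF}_{sc}u\iff(\xi,\theta)\in\mathrm{WF}(\mathcal F u),$$ and the quadratic-scattering wavefront set is $\mathrm{WF}_{qsc}u=\mathrm{WF}_{sc}\tilde u$, where $\tilde u(z)=u(z/\sqrt{|z|})$.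 Here, since a distribution cannot be pulled back by $z\mapsto z/\sqrt{|z|}$ at $z=0$, $\tilde u$ is understood to be cut off near the origin: $\langle\tilde u,\varphi\rangle=\langle u,\ \chi(w)\,2|w|^n\varphi(|w|w)\rangle$ for $\varphi\in\mathcal S(\mathbb R^n)$, where $\chi$ is a fixed smooth function that vanishes near the origin and equals $1$ near infinity (another choice of $\chi$ changes $\tilde u$ by a compactly supported distribution, and hence does not change $\mathrm{WF}_{sc}\tilde u$). **Proposition.** Let $u\in\mathcal S'(\mathbb R^n)$ and $\theta\in S^{n-1}$. If $(\theta,0)\notin\mathrm{WF}_{qsc}u$, then $(\theta,\xi)\notin\mathrm{WF}_{sc}u$ for every $\xi\in\mathbb R^n$. -/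

import Mathlib

open scoped SchwartzMap FourierTransform ContDiff Topology
open MeasureTheory

noncomputable section

namespace ScatteringWF

/-- Euclidean space `ℝⁿ`, with the Euclidean norm and inner product. -/
abbrev RSpace (n : ℕ) : Type := EuclideanSpace ℝ (Fin n)

/-- The unit sphere `Sⁿ⁻¹` of `ℝⁿ`. -/
abbrev USphere (n : ℕ) : Type := Metric.sphere (0 : RSpace n) 1

variable {n : ℕ}

/-! ### The Fourier transform with kernel `e^{-i x·ζ}` -/

/-- The dilation `x ↦ (2π)⁻¹ x` of `ℝⁿ`. -/
def dilation (n : ℕ) : RSpace n ≃L[ℝ] RSpace n :=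
  ContinuousLinearEquiv.smulLeft (Units.mk0 (2 * Real.pi)⁻¹ (inv_ne_zero Real.two_pi_pos.ne'))

/-- The Fourier transform `(F φ)(ζ) = ∫ e^{-i x·ζ} φ(x) dx` on Schwartz functions
(see `schwartzFourier_apply`); Mathlib's `𝓕` has the kernel `e^{-2πi x·ζ}`. -/
def schwartzFourier (n : ℕ) : 𝓢(RSpace n, ℂ) →L[ℂ] 𝓢(RSpace n, ℂ) :=
  SchwartzMap.compCLMOfContinuousLinearEquiv ℂ (dilation n) ∘L
    FourierTransform.fourierCLM ℂ 𝓢(RSpace n, ℂ)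

theorem schwartzFourier_apply (φ : 𝓢(RSpace n, ℂ)) (ζ : RSpace n) :
    schwartzFourier n φ ζ = ∫ x, Complex.exp (-Complex.I * (inner ℝ x ζ : ℝ)) * φ x := by
  have h : schwartzFourier n φ ζ = 𝓕 (φ : RSpace n → ℂ) ((2 * Real.pi)⁻¹ • ζ) := rfl
  rw [h, Real.fourier_eq']
  congr 1
  ext x
  rw [inner_smul_right, smul_eq_mul]
  congr 2
  have := Real.pi_ne_zero
  push_cast
  field_simp

/-- The Fourier transform of a tempered distribution, `⟨F u, φ⟩ = ⟨u, F φ⟩`. -/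
def distFourier (u : 𝓢'(RSpace n, ℂ)) : 𝓢'(RSpace n, ℂ) :=
  PointwiseConvergenceCLM.precomp ℂ (schwartzFourier n) u

/-! ### The wavefront set -/

/-- The test function `x ↦ e^{-i x·η} φ(x)`, for a smooth compactly supported `φ`. -/
def modulate (φ : RSpace n → ℂ) (hc : HasCompactSupport φ) (hs : ContDiff ℝ ∞ φ)
    (η : RSpace n) : 𝓢(RSpace n, ℂ) :=
  HasCompactSupport.toSchwartzMap
    (f := fun x ↦ Complex.exp (-Complex.I * (inner ℝ x η : ℝ)) * φ x)
    hc.mul_left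
    (((contDiff_const.mul
      (Complex.ofRealCLM.contDiff.comp (contDiff_id.inner ℝ contDiff_const))).cexp).mul hs)

/-- The point `(x, θ)` is *not* in the wavefront set of `v`: for some smooth compactly supported
`φ` with `φ(x) ≠ 0`, the Fourier transform `F(φ v)(η) = ⟨v, φ e^{-i⟨·,η⟩}⟩` of the compactly
supported distribution `φ v` decays faster than every power of `|η|`, uniformly for `η` in a
conic neighbourhood of `θ`. -/
def IsMicrolocallySmoothAt (v : 𝓢'(RSpace n, ℂ)) (x : RSpace n) (θ : USphere n) : Prop :=
  ∃ (φ : RSpace n → ℂ) (hc : HasCompactSupport φ) (hs : ContDiff ℝ ∞ φ), φ x ≠ 0 ∧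
    ∃ U ∈ 𝓝 θ, ∀ N : ℕ, ∃ C : ℝ, ∀ θ' ∈ U, ∀ r : ℝ, 0 < r →
      ‖v (modulate φ hc hs (r • (θ' : RSpace n)))‖ ≤ C / (1 + r) ^ N

/-- Hörmander's wavefront set, as a subset of `S*ℝⁿ = ℝⁿ × Sⁿ⁻¹`. -/
def WF (v : 𝓢'(RSpace n, ℂ)) : Set (RSpace n × USphere n) :=
  {p | ¬ IsMicrolocallySmoothAt v p.1 p.2}

/-- The scattering wavefront set, a subset of `Sⁿ⁻¹ × ℝⁿ`. -/
def WFsc (u : 𝓢'(RSpace n, ℂ)) : Set (USphere n × RSpace n) :=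
  {p | (p.2, p.1) ∈ WF (distFourier u)}

/-! ### The rescaled distribution `ũ(z) = u(z / √|z|)`

The map `z ↦ z / √|z|` is a homeomorphism of `ℝⁿ`, smooth with smooth inverse `w ↦ |w| w` away from
the origin, and the Jacobian determinant of `w ↦ |w| w` is `2 |w|ⁿ`. Hence formally
`⟨ũ, φ⟩ = ∫ u(z / √|z|) φ(z) dz = ∫ u(w) φ(|w| w) 2|w|ⁿ dw`. As a distribution cannot be pulled back
at the singular point `z = 0`, the right-hand side is multiplied by a cutoff which is `0` near the
origin and `1` near infinity. Changing the cutoff changes `ũ` by a compactly supported distribution,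
whose Fourier transform is smooth, so that `WFsc ũ` does not depend on it. -/

/-- A bump function: `1` for `|w| ≤ 1`, and `0` for `|w| ≥ 2`. -/
def innerBump (n : ℕ) : ContDiffBump (0 : RSpace n) := ⟨1, 2, by norm_num, by norm_num⟩

/-- A bump function: `1` for `|w| ≤ 2`, and `0` for `|w| ≥ 3`. -/
def outerBump (n : ℕ) : ContDiffBump (0 : RSpace n) := ⟨2, 3, by norm_num, by norm_num⟩

/-- The cutoff: smooth, `0` for `|w| ≤ 2` and `1` for `|w| ≥ 3`. -/
def cutoff (w : RSpace n) : ℝ := 1 - outerBump n w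

/-- A smooth positive function that is equal to `|w|` for `|w| ≥ 2`. -/
def smoothNorm (w : RSpace n) : ℝ := Real.sqrt (‖w‖ ^ 2 + innerBump n w)

theorem cutoff_eq_zero {w : RSpace n} (hw : ‖w‖ ≤ 2) : cutoff w = 0 := by
  have : outerBump n w = 1 := (outerBump n).one_of_mem_closedBall (by simpa [outerBump] using hw)
  simp [cutoff, this]

theorem cutoff_eq_one {w : RSpace n} (hw : 3 ≤ ‖w‖) : cutoff w = 1 := by
  have : outerBump n w = 0 := (outerBump n).zero_of_le_dist (by simpa [outerBump] using hw)
  simp [cutoff, this]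

theorem smoothNorm_eq {w : RSpace n} (hw : 2 ≤ ‖w‖) : smoothNorm w = ‖w‖ := by
  have : innerBump n w = 0 := (innerBump n).zero_of_le_dist (by simpa [innerBump] using hw)
  simp [smoothNorm, this]

theorem one_le_sq_add (w : RSpace n) : 1 ≤ ‖w‖ ^ 2 + innerBump n w := by
  by_cases hw : ‖w‖ ≤ 1
  · have : innerBump n w = 1 := (innerBump n).one_of_mem_closedBall (by simpa [innerBump] using hw)
    rw [this]
    nlinarith [sq_nonneg ‖w‖]
  · have := (innerBump n).nonneg (x := w)
    nlinarith

theorem norm_le_smoothNorm (w : RSpace n) : ‖w‖ ≤ smoothNorm w :=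
  Real.le_sqrt_of_sq_le (by linarith [(innerBump n).nonneg (x := w)])

theorem one_le_smoothNorm (w : RSpace n) : 1 ≤ smoothNorm w :=
  Real.one_le_sqrt.2 (one_le_sq_add w)

theorem bump_temperate (b : ContDiffBump (0 : RSpace n)) :
    Function.HasTemperateGrowth (fun w ↦ b w) :=
  b.hasCompactSupport.hasTemperateGrowth b.contDiff

theorem cutoff_temperate : Function.HasTemperateGrowth (cutoff (n := n)) :=
  (Function.HasTemperateGrowth.const (1 : ℝ)).sub (bump_temperate (outerBump n))

theorem sqrt_temperate {p : RSpace n → ℝ} (hp : p.HasTemperateGrowth) (h1 : ∀ w, 1 ≤ p w) :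
    Function.HasTemperateGrowth (fun w ↦ Real.sqrt (p w)) := by
  have hfun : (fun w ↦ Real.sqrt (p w)) = (fun y : ℝ ↦ y ^ (1 / 2 : ℝ)) ∘ p := by
    ext w
    simp [Real.sqrt_eq_rpow]
  rw [hfun]
  have hunique : UniqueDiffOn ℝ (Set.Ioi (1 / 2 : ℝ)) := isOpen_Ioi.uniqueDiffOn
  refine Function.HasTemperateGrowth.comp' (t := Set.Ioi (1 / 2 : ℝ)) ?_ hunique ?_ ?_ hp
  · rintro _ ⟨w, rfl⟩
    exact lt_of_lt_of_le (by norm_num) (h1 w)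
  · exact contDiffOn_fun_id.rpow_const_of_ne fun x hx ↦ (lt_trans (by norm_num) hx).ne'
  · intro N
    refine ⟨1, ∑ k ∈ Finset.range (N + 1),
      ‖Polynomial.eval (1 / 2 : ℝ) (descPochhammer ℝ k)‖ * 2 ^ k, by positivity, ?_⟩
    intro k hk x hx
    have hx2 : 1 / 2 < x := hx
    have hx0 : 0 < x := lt_trans (by norm_num) hx2
    have hd : ContDiffAt ℝ k (fun x : ℝ ↦ x ^ (1 / 2 : ℝ)) x :=
      Real.contDiffAt_rpow_const <| Or.inl hx0.ne'
    rw [norm_iteratedFDerivWithin_eq_norm_iteratedDerivWithin,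
      iteratedDerivWithin_eq_iteratedDeriv hunique hd hx, iteratedDeriv_eq_iterate,
      Real.iter_deriv_rpow_const, norm_mul]
    have hb : ‖x ^ ((1 / 2 : ℝ) - k)‖ ≤ 2 ^ k * (1 + ‖x‖) ^ 1 := by
      rw [Real.norm_of_nonneg (by positivity), Real.norm_of_nonneg hx0.le, pow_one,
        Real.rpow_sub hx0, Real.rpow_natCast, ← Real.sqrt_eq_rpow, div_eq_mul_inv, mul_comm,
        ← inv_pow]
      have h2 : x⁻¹ ≤ 2 := by
        rw [inv_le_comm₀ hx0 (by norm_num)]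
        linarith
      have h3 : Real.sqrt x ≤ 1 + x := by
        rw [Real.sqrt_le_left (by linarith)]
        nlinarith
      gcongr
    calc _ ≤ ‖Polynomial.eval (1 / 2 : ℝ) (descPochhammer ℝ k)‖ * (2 ^ k * (1 + ‖x‖) ^ 1) := by
          gcongr
      _ = ‖Polynomial.eval (1 / 2 : ℝ) (descPochhammer ℝ k)‖ * 2 ^ k * (1 + ‖x‖) ^ 1 := by ring
      _ ≤ _ := by
          gcongr
          exact Finset.single_le_sum
            (f := fun k ↦ ‖Polynomial.eval (1 / 2 : ℝ) (descPochhammer ℝ k)‖ * 2 ^ k)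
            (fun _ _ ↦ by positivity) (Finset.mem_range.2 (by omega))

theorem smoothNorm_temperate : Function.HasTemperateGrowth (smoothNorm (n := n)) :=
  sqrt_temperate ((Function.hasTemperateGrowth_norm_sq (RSpace n)).add
    (bump_temperate (innerBump n))) one_le_sq_add

/-- A smooth map that is equal to `w ↦ |w| w` for `|w| ≥ 2`. -/
def stretch (w : RSpace n) : RSpace n := smoothNorm w • w

theorem stretch_temperate : Function.HasTemperateGrowth (stretch (n := n)) :=
  smoothNorm_temperate.smul Function.HasTemperateGrowth.id

theorem stretch_lower :
    ∃ (k : ℕ) (C : ℝ), ∀ w : RSpace n, ‖w‖ ≤ C * (1 + ‖stretch w‖) ^ k := by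
  refine ⟨1, 1, fun w ↦ ?_⟩
  have h := one_le_smoothNorm w
  rw [stretch, norm_smul, Real.norm_of_nonneg (by linarith)]
  nlinarith [norm_nonneg w]

/-- The weight `2 |w|ⁿ`, cut off near the origin. -/
def weight (w : RSpace n) : ℂ := ((cutoff w * (2 * smoothNorm w ^ n) : ℝ) : ℂ)

theorem weight_temperate : Function.HasTemperateGrowth (weight (n := n)) :=
  Function.Complex.hasTemperateGrowth_ofReal.comp
    (cutoff_temperate.mul ((Function.HasTemperateGrowth.const (2 : ℝ)).mul
      (smoothNorm_temperate.pow n)))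

/-- The transposed operator `φ ↦ (w ↦ cutoff(w) · 2|w|ⁿ · φ(|w| w))`, see `transposeRescale_apply`. -/
def transposeRescale (n : ℕ) : 𝓢(RSpace n, ℂ) →L[ℂ] 𝓢(RSpace n, ℂ) :=
  SchwartzMap.smulLeftCLM ℂ weight ∘L SchwartzMap.compCLM ℂ stretch_temperate stretch_lower

theorem transposeRescale_apply (φ : 𝓢(RSpace n, ℂ)) (w : RSpace n) :
    transposeRescale n φ w = ((cutoff w * (2 * ‖w‖ ^ n) : ℝ) : ℂ) * φ (‖w‖ • w) := by
  have h : transposeRescale n φ w = weight w * φ (stretch w) := by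
    simp [transposeRescale, SchwartzMap.smulLeftCLM_apply_apply weight_temperate]
  rw [h, weight, stretch]
  rcases le_total ‖w‖ 2 with hw | hw
  · simp [cutoff_eq_zero hw]
  · rw [smoothNorm_eq hw]

/-- The distribution `ũ(z) = u(z / √|z|)`, cut off near the origin. -/
def rescale (u : 𝓢'(RSpace n, ℂ)) : 𝓢'(RSpace n, ℂ) :=
  PointwiseConvergenceCLM.precomp ℂ (transposeRescale n) u

theorem rescale_apply (u : 𝓢'(RSpace n, ℂ)) (φ : 𝓢(RSpace n, ℂ)) :
    rescale u φ = u (transposeRescale n φ) := rfl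

/-- The quadratic-scattering wavefront set, a subset of `Sⁿ⁻¹ × ℝⁿ`. -/
def WFqsc (u : 𝓢'(RSpace n, ℂ)) : Set (USphere n × RSpace n) := WFsc (rescale u)

end ScatteringWF

end

noncomputable section

namespace ScatteringWF

variable {n : ℕ}

/-! ### Interchange of a tempered distribution with an integral of Schwartz functions -/

section Interchange

variable {E : Type*} [NormedAddCommGroup E] [NormedSpace ℝ E]

/-! Let `ψ` be a cutoff at ξ and Ψ = Fψ. Pairing F u with `ψ` modulated to frequency sη, |η| = 1,
means testing u on Ψ(w + sη), a packet of unit width around w = -sη. The substitution z = |w|w moves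
this packet to distance about s² from the origin and widens it to about s, so that its frequencies
are of size 1/s. They tend to 0 as s → ∞ whatever ξ is, which is why regularity of ũ at frequency 0
alone controls every ξ.

To make this precise, the packet is cut off by a(-w/s), with a = 1 near θ. The rest is supported
where |w + sη| is at least a multiple of s, and Ψ is rapidly decreasing there
(`exists_norm_apply_translate_le`). The main part is exactly the transposed rescaling of F F h_s
(`transposeRescale_source`), where h_s(y) = s⁻ⁿ h(s⁻² y), h is supported near θ, and D^q h = O(s^q)
(`norm_iteratedFDeriv_source_le`). Pairing it with u is therefore pairing T = F ũ with F h_s.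

It remains to see that T(F h_s) is rapidly decreasing in s. Take a cutoff κ that is 1 near 0 and for
which F(κT) decays in a cone around θ (`exists_cutoff`). Then T(κ F h_s) is the integral of h_s
against F(κT), over points of the cone of size s² (`exists_norm_apply_mul_le`). Away from 0, F
h_s(x) = sⁿ F h(s² x) is small: each integration by parts costs a factor s from differentiating h
and gains s² from the argument (`exists_norm_apply_one_sub_mul_le`). -/

theorem norm_temperedDistribution_le (T : 𝓢'(E, ℂ)) :
    ∃ (s : Finset (ℕ × ℕ)) (C : ℝ), 0 ≤ C ∧ ∀ f : 𝓢(E, ℂ), ∀ B : ℝ, 0 ≤ B →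
      (∀ i ∈ s, ∀ x, ‖x‖ ^ i.1 * ‖iteratedFDeriv ℝ i.2 f x‖ ≤ B) → ‖T f‖ ≤ C * B := by
  have hc : Continuous ((normSeminorm ℂ ℂ).comp (T : 𝓢(E, ℂ) →ₗ[ℂ] ℂ)) :=
    continuous_norm.comp T.continuous
  obtain ⟨s, C, -, hC⟩ := Seminorm.bound_of_continuous (schwartz_withSeminorms ℂ E ℂ) _ hc
  refine ⟨s, C, C.2, fun f B hB h ↦ (hC f).trans ?_⟩
  rw [smul_apply, NNReal.smul_def, smul_eq_mul]
  refine mul_le_mul_of_nonneg_left ?_ C.2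
  exact Seminorm.finset_sup_apply_le hB fun i hi ↦ SchwartzMap.seminorm_le_bound ℂ _ _ f hB (h i hi)

variable (E) in
/-- Bounded continuous functions with values in the `l`-multilinear forms on `E`. -/
def DerivSpace (l : ℕ) : Type _ := BoundedContinuousFunction E (E [×l]→L[ℝ] ℂ)

instance (l : ℕ) : NormedAddCommGroup (DerivSpace E l) :=
  inferInstanceAs (NormedAddCommGroup (BoundedContinuousFunction E (E [×l]→L[ℝ] ℂ)))

instance (l : ℕ) : NormedSpace ℂ (DerivSpace E l) :=
  inferInstanceAs (NormedSpace ℂ (BoundedContinuousFunction E (E [×l]→L[ℝ] ℂ)))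

instance (l : ℕ) : CompleteSpace (DerivSpace E l) :=
  inferInstanceAs (CompleteSpace (BoundedContinuousFunction E (E [×l]→L[ℝ] ℂ)))

/-- The evaluation at a point `x` and vectors `m`. -/
def derivEval {l : ℕ} (x : E) (m : Fin l → E) : DerivSpace E l →L[ℂ] ℂ :=
  LinearMap.mkContinuous
    { toFun := fun φ ↦ (show BoundedContinuousFunction E (E [×l]→L[ℝ] ℂ) from φ) x m
      map_add' := fun _ _ ↦ rfl
      map_smul' := fun _ _ ↦ rfl } (∏ i, ‖m i‖) fun φ ↦ by
    rw [mul_comm]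
    refine (ContinuousMultilinearMap.le_opNorm _ _).trans ?_
    gcongr
    exact BoundedContinuousFunction.norm_coe_le_norm
      (show BoundedContinuousFunction E (E [×l]→L[ℝ] ℂ) from φ) x

theorem derivSpace_ext {l : ℕ} {φ ψ : DerivSpace E l}
    (h : ∀ x m, derivEval x m φ = derivEval x m ψ) : φ = ψ :=
  BoundedContinuousFunction.ext fun x ↦ ContinuousMultilinearMap.ext fun m ↦ h x m

/-- The bounded continuous function `x ↦ |x|^k D^l f(x)`. -/
def weightedDeriv (k l : ℕ) : 𝓢(E, ℂ) →ₗ[ℂ] DerivSpace E l where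
  toFun f := BoundedContinuousFunction.ofNormedAddCommGroup
    (fun x ↦ ‖x‖ ^ k • iteratedFDeriv ℝ l f x)
    ((continuous_norm.pow k).smul
      ((f.smooth ⊤).continuous_iteratedFDeriv (by exact_mod_cast le_top)))
    (SchwartzMap.seminorm ℝ k l f) fun x ↦ by
      rw [norm_smul, norm_pow, norm_norm]
      exact f.le_seminorm ℝ k l x
  map_add' f g := by
    refine BoundedContinuousFunction.ext fun x ↦ ?_
    have : iteratedFDeriv ℝ l (⇑(f + g)) x = iteratedFDeriv ℝ l f x + iteratedFDeriv ℝ l g x :=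
      iteratedFDeriv_add_apply (f.smooth l).contDiffAt (g.smooth l).contDiffAt
    change ‖x‖ ^ k • iteratedFDeriv ℝ l (⇑(f + g)) x =
      ‖x‖ ^ k • iteratedFDeriv ℝ l f x + ‖x‖ ^ k • iteratedFDeriv ℝ l g x
    rw [this, smul_add]
  map_smul' c f := by
    refine BoundedContinuousFunction.ext fun x ↦ ?_
    have : iteratedFDeriv ℝ l (⇑(c • f)) x = c • iteratedFDeriv ℝ l f x :=
      iteratedFDeriv_const_smul_apply (f.smooth l).contDiffAt
    change ‖x‖ ^ k • iteratedFDeriv ℝ l (⇑(c • f)) x = c • (‖x‖ ^ k • iteratedFDeriv ℝ l f x)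
    rw [this, smul_comm]

theorem derivEval_weightedDeriv (k l : ℕ) (f : 𝓢(E, ℂ)) (x : E) (m : Fin l → E) :
    derivEval x m (weightedDeriv k l f) = ‖x‖ ^ k • iteratedFDeriv ℝ l f x m := rfl

theorem le_norm_weightedDeriv (k l : ℕ) (f : 𝓢(E, ℂ)) (x : E) :
    ‖x‖ ^ k * ‖iteratedFDeriv ℝ l f x‖ ≤ ‖weightedDeriv k l f‖ := by
  have h := BoundedContinuousFunction.norm_coe_le_norm
    (show BoundedContinuousFunction E (E [×l]→L[ℝ] ℂ) from weightedDeriv k l f) x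
  change ‖‖x‖ ^ k • iteratedFDeriv ℝ l f x‖ ≤ _ at h
  rwa [norm_smul, norm_pow, norm_norm] at h

theorem norm_weightedDeriv_le (k l : ℕ) (f : 𝓢(E, ℂ)) :
    ‖weightedDeriv k l f‖ ≤ SchwartzMap.seminorm ℝ k l f :=
  (BoundedContinuousFunction.norm_le (apply_nonneg _ _)).2 fun x ↦ by
    change ‖‖x‖ ^ k • iteratedFDeriv ℝ l f x‖ ≤ _
    rw [norm_smul, norm_pow, norm_norm]
    exact f.le_seminorm ℝ k l x

theorem continuous_weightedDeriv (k l : ℕ) : Continuous (weightedDeriv (E := E) k l) := by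
  refine (schwartz_withSeminorms ℂ E ℂ).continuous_normedSpace_rng _ _ ⟨{(k, l)}, 1, ?_⟩
  intro f
  have : SchwartzMap.seminorm ℂ k l f = SchwartzMap.seminorm ℝ k l f := by
    simp only [SchwartzMap.seminorm_apply]
  simpa [this] using norm_weightedDeriv_le k l f

/-- The bound makes `T` vanish on the kernel of `J`, so it descends to a bounded functional on the
range of `J`, which Hahn–Banach extends to `W`. With `W` a Banach space, Bochner integration in `W`
becomes available for distributions. -/
theorem exists_factor_of_norm_le {V W : Type*} [AddCommGroup V] [Module ℂ V]
    [NormedAddCommGroup W] [NormedSpace ℂ W] (T : V →ₗ[ℂ] ℂ) (J : V →ₗ[ℂ] W) (C : ℝ)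
    (hJ : ∀ f, ‖T f‖ ≤ C * ‖J f‖) : ∃ L : W →L[ℂ] ℂ, ∀ f, T f = L (J f) := by
  have hker : LinearMap.ker J ≤ LinearMap.ker T := fun f hf ↦ by
    have := hJ f
    rw [LinearMap.mem_ker.1 hf, norm_zero, mul_zero] at this
    simpa using this
  let l : LinearMap.range J →ₗ[ℂ] ℂ :=
    (LinearMap.ker J).liftQ T hker ∘ₗ J.quotKerEquivRange.symm.toLinearMap
  have hl : ∀ f, l ⟨J f, LinearMap.mem_range_self J f⟩ = T f := fun f ↦ by
    have := J.quotKerEquivRange_symm_apply_image f (LinearMap.mem_range_self J f)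
    simp only [l, LinearMap.comp_apply, LinearEquiv.coe_coe]
    rw [this]
    rfl
  let lc : StrongDual ℂ (LinearMap.range J) := l.mkContinuous C <| by
    rintro ⟨_, f, rfl⟩
    rw [hl]
    exact hJ f
  obtain ⟨L, hL, -⟩ := exists_extension_norm_eq _ lc
  refine ⟨L, fun f ↦ ?_⟩
  rw [← hl f]
  exact (hL ⟨J f, LinearMap.mem_range_self J f⟩).symm

/-- A tempered distribution factors through finitely many of the maps `weightedDeriv k l`. -/
theorem exists_factor_weightedDeriv (T : 𝓢'(E, ℂ)) : ∃ (s : Finset (ℕ × ℕ))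
    (L : ((i : s) → DerivSpace E i.1.2) →L[ℂ] ℂ),
    ∀ f, T f = L fun i ↦ weightedDeriv i.1.1 i.1.2 f := by
  obtain ⟨s, C, hC0, hC⟩ := norm_temperedDistribution_le T
  let J : 𝓢(E, ℂ) →ₗ[ℂ] ((i : s) → DerivSpace E i.1.2) :=
    LinearMap.pi fun i ↦ weightedDeriv i.1.1 i.1.2
  obtain ⟨L, hL⟩ := exists_factor_of_norm_le (T : 𝓢(E, ℂ) →ₗ[ℂ] ℂ) J C fun f ↦
    hC f ‖J f‖ (norm_nonneg _) fun i hi x ↦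
      (le_norm_weightedDeriv i.1 i.2 f x).trans (norm_le_pi_norm (J f) ⟨i, hi⟩)
  exact ⟨s, L, hL⟩

variable {Y : Type*} [TopologicalSpace Y] [SecondCountableTopology Y] [MeasurableSpace Y]
  [OpensMeasurableSpace Y] {μ : Measure Y} {Φ : Y → 𝓢(E, ℂ)}

omit [SecondCountableTopology Y] [MeasurableSpace Y] [OpensMeasurableSpace Y] in
theorem continuous_eval (hΦ : Continuous Φ) (x : E) : Continuous fun y ↦ Φ y x :=
  ((BoundedContinuousFunction.evalCLM ℂ x).continuous.comp
    (SchwartzMap.toBoundedContinuousFunctionCLM ℂ E ℂ).continuous).comp hΦ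

omit [SecondCountableTopology Y] in
theorem integrable_eval (hΦ : Continuous Φ)
    (hint : ∀ k l, Integrable (fun y ↦ SchwartzMap.seminorm ℝ k l (Φ y)) μ) (x : E) :
    Integrable (fun y ↦ Φ y x) μ :=
  (hint 0 0).mono' (continuous_eval hΦ x).aestronglyMeasurable
    (Filter.Eventually.of_forall fun y ↦ SchwartzMap.norm_le_seminorm ℝ (Φ y) x)

open LineDeriv

theorem continuous_seminorm (k l : ℕ) :
    Continuous (SchwartzMap.seminorm ℝ k l : Seminorm ℝ 𝓢(E, ℂ)) :=
  (schwartz_withSeminorms ℝ E ℂ).continuous_seminorm (k, l)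

theorem seminorm_lineDeriv_le (k l : ℕ) (m : E) (f : 𝓢(E, ℂ)) :
    SchwartzMap.seminorm ℝ k l (∂_{m} f : 𝓢(E, ℂ)) ≤ ‖m‖ * SchwartzMap.seminorm ℝ k (l + 1) f := by
  refine SchwartzMap.seminorm_le_bound _ _ _ _ (by positivity) fun x ↦ ?_
  have h : iteratedFDeriv ℝ l (⇑(∂_{m} f : 𝓢(E, ℂ))) x =
      (ContinuousLinearMap.apply ℝ ℂ m).compContinuousMultilinearMap
        (iteratedFDeriv ℝ l (fderiv ℝ f) x) :=
    (ContinuousLinearMap.apply ℝ ℂ m).iteratedFDeriv_comp_left (f := fderiv ℝ f) (n := l)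
      ((f.smooth (l + 1)).fderiv_right (by norm_cast)).contDiffAt le_rfl
  have h2 : ‖iteratedFDeriv ℝ l (⇑(∂_{m} f : 𝓢(E, ℂ))) x‖ ≤ ‖m‖ * ‖iteratedFDeriv ℝ (l + 1) f x‖ := by
    rw [h, ← norm_iteratedFDeriv_fderiv]
    refine (ContinuousLinearMap.norm_compContinuousMultilinearMap_le _ _).trans ?_
    gcongr
    refine ContinuousLinearMap.opNorm_le_bound _ (norm_nonneg _) fun L ↦ ?_
    rw [ContinuousLinearMap.apply_apply, mul_comm]
    exact L.le_opNorm m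
  calc _ ≤ ‖x‖ ^ k * (‖m‖ * ‖iteratedFDeriv ℝ (l + 1) f x‖) := by gcongr
    _ = ‖m‖ * (‖x‖ ^ k * ‖iteratedFDeriv ℝ (l + 1) f x‖) := by ring
    _ ≤ _ := by gcongr; exact f.le_seminorm ℝ k (l + 1) x

omit [SecondCountableTopology Y] in
theorem integrable_seminorm_lineDeriv (hΦ : Continuous Φ)
    (hint : ∀ k l, Integrable (fun y ↦ SchwartzMap.seminorm ℝ k l (Φ y)) μ) (m : E) (k l : ℕ) :
    Integrable (fun y ↦ SchwartzMap.seminorm ℝ k l (∂_{m} (Φ y))) μ := by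
  refine ((hint k (l + 1)).const_mul ‖m‖).mono' ?_ (Filter.Eventually.of_forall fun y ↦ ?_)
  · exact ((continuous_seminorm k l).comp
      ((ContinuousLineDeriv.continuous_lineDerivOp m).comp hΦ)).aestronglyMeasurable
  · rw [Real.norm_of_nonneg (apply_nonneg _ _)]
    exact seminorm_lineDeriv_le k l m _

omit [SecondCountableTopology Y] in
theorem lineDeriv_eq_integral (hΦ : Continuous Φ)
    (hint : ∀ k l, Integrable (fun y ↦ SchwartzMap.seminorm ℝ k l (Φ y)) μ) {f : 𝓢(E, ℂ)}
    (hf : ∀ x, f x = ∫ y, Φ y x ∂μ) (m x : E) : ∂_{m} f x = ∫ y, ∂_{m} (Φ y) x ∂μ := by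
  have key := hasDerivAt_integral_of_dominated_loc_of_deriv_le (μ := μ) (𝕜 := ℝ) (x₀ := 0)
    (s := Set.univ) (F := fun t y ↦ Φ y (x + t • m)) (F' := fun t y ↦ ∂_{m} (Φ y) (x + t • m))
    -- The sup norm of the derivative dominates for all `t` at once, so no neighbourhood has to be
    -- chosen.
    (bound := fun y ↦ SchwartzMap.seminorm ℝ 0 0 (∂_{m} (Φ y))) Filter.univ_mem
    (Filter.Eventually.of_forall fun t ↦ (continuous_eval hΦ _).aestronglyMeasurable)
    (integrable_eval hΦ hint _)
    (continuous_eval ((ContinuousLineDeriv.continuous_lineDerivOp m).comp hΦ)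
      _).aestronglyMeasurable
    (Filter.Eventually.of_forall fun y t _ ↦ SchwartzMap.norm_le_seminorm ℝ _ _)
    (integrable_seminorm_lineDeriv hΦ hint m 0 0)
    (Filter.Eventually.of_forall fun y t _ ↦ by
      have h1 := (Φ y).hasFDerivAt (x + t • m)
      have h2 : HasDerivAt (fun t : ℝ ↦ x + t • m) m t := by
        simpa using ((hasDerivAt_id t).smul_const m).const_add x
      exact h1.comp_hasDerivAt t h2)
  have h1 := key.2
  simp only [← hf] at h1
  have h3 : HasDerivAt (fun t : ℝ ↦ f (x + t • m)) (∂_{m} f (x + (0 : ℝ) • m)) 0 := by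
    have h2 : HasDerivAt (fun t : ℝ ↦ x + t • m) m 0 := by
      simpa using ((hasDerivAt_id (0 : ℝ)).smul_const m).const_add x
    exact (f.hasFDerivAt (x + (0 : ℝ) • m)).comp_hasDerivAt 0 h2
  simpa using h3.unique h1

omit [SecondCountableTopology Y] in
theorem iteratedLineDeriv_eq_integral {l : ℕ} (m : Fin l → E) : ∀ {Φ : Y → 𝓢(E, ℂ)},
    Continuous Φ → (∀ k l, Integrable (fun y ↦ SchwartzMap.seminorm ℝ k l (Φ y)) μ) →
    ∀ {f : 𝓢(E, ℂ)}, (∀ x, f x = ∫ y, Φ y x ∂μ) →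
    ∀ x, ∂^{m} f x = ∫ y, ∂^{m} (Φ y) x ∂μ := by
  induction l with
  | zero => intro Φ _ _ f hf x; simpa using hf x
  | succ l ih =>
    intro Φ hΦ hint f hf x
    -- This peels off the derivative that is applied first; the induction hypothesis is then used
    -- for the differentiated family, hence the quantification over `Φ` and `f`.
    simp only [iteratedLineDerivOp_succ_right]
    exact ih _ ((ContinuousLineDeriv.continuous_lineDerivOp _).comp hΦ)
      (integrable_seminorm_lineDeriv hΦ hint _) (lineDeriv_eq_integral hΦ hint hf _) x

/-- A tempered distribution commutes with the integral of a family of Schwartz functions. -/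
theorem temperedDistribution_integral (T : 𝓢'(E, ℂ)) (hΦ : Continuous Φ)
    (hint : ∀ k l, Integrable (fun y ↦ SchwartzMap.seminorm ℝ k l (Φ y)) μ) {f : 𝓢(E, ℂ)}
    (hf : ∀ x, f x = ∫ y, Φ y x ∂μ) : T f = ∫ y, T (Φ y) ∂μ := by
  obtain ⟨s, L, hL⟩ := exists_factor_weightedDeriv T
  have hi : ∀ i : s, Integrable (fun y ↦ weightedDeriv i.1.1 i.1.2 (Φ y)) μ := fun i ↦
    (hint i.1.1 i.1.2).mono' ((continuous_weightedDeriv _ _).comp hΦ).aestronglyMeasurable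
      (Filter.Eventually.of_forall fun y ↦ norm_weightedDeriv_le _ _ _)
  -- The Bochner integral is identified by continuous functionals that separate points, the
  -- evaluations of derivatives, for which the claim is differentiation under the integral.
  have hJ : (fun i : s ↦ weightedDeriv i.1.1 i.1.2 f) =
      ∫ y, (fun i : s ↦ weightedDeriv i.1.1 i.1.2 (Φ y)) ∂μ := by
    funext i
    rw [eval_integral hi]
    refine derivSpace_ext fun x m ↦ ?_
    have h := (derivEval x m).integral_comp_comm (hi i)
    simp only [derivEval_weightedDeriv, ← SchwartzMap.iteratedLineDerivOp_eq_iteratedFDeriv] at h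
    rw [← h, derivEval_weightedDeriv, ← SchwartzMap.iteratedLineDerivOp_eq_iteratedFDeriv,
      integral_smul, iteratedLineDeriv_eq_integral m hΦ hint hf]
  rw [hL, hJ, ← L.integral_comp_comm (Integrable.of_eval hi)]
  simp only [hL]

end Interchange

/-! ### Leibniz bounds for weighted derivatives of products -/

section Products

variable {E : Type*} [NormedAddCommGroup E] [NormedSpace ℝ E]

theorem norm_iteratedFDeriv_mul_le_of_le {c f : E → ℂ} (hc : ContDiff ℝ ∞ c)
    (hf : ContDiff ℝ ∞ f) (x : E) (l : ℕ) {A B : ℝ}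
    (hA : ∀ i ≤ l, ‖iteratedFDeriv ℝ i c x‖ ≤ A) (hB : ∀ i ≤ l, ‖iteratedFDeriv ℝ i f x‖ ≤ B) :
    ‖iteratedFDeriv ℝ l (fun y ↦ c y * f y) x‖ ≤ 2 ^ l * A * B := by
  have hA0 : 0 ≤ A := (norm_nonneg _).trans (hA 0 (Nat.zero_le l))
  have hB0 : 0 ≤ B := (norm_nonneg _).trans (hB 0 (Nat.zero_le l))
  calc _ ≤ ∑ i ∈ Finset.range (l + 1), (l.choose i : ℝ) * ‖iteratedFDeriv ℝ i c x‖ *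
        ‖iteratedFDeriv ℝ (l - i) f x‖ :=
      norm_iteratedFDeriv_mul_le hc hf x (by exact_mod_cast le_top)
    _ ≤ ∑ i ∈ Finset.range (l + 1), (l.choose i : ℝ) * A * B := by
      refine Finset.sum_le_sum fun i hi ↦ ?_
      have := Finset.mem_range_succ_iff.1 hi
      gcongr
      · exact hA i this
      · exact hB _ (Nat.sub_le _ _)
    _ = 2 ^ l * A * B := by
      rw [← Finset.sum_mul, ← Finset.sum_mul]
      congr 2
      exact_mod_cast Nat.sum_range_choose l

theorem pow_mul_norm_iteratedFDeriv_mul_le {c f : E → ℂ} (hc : ContDiff ℝ ∞ c)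
    (hf : ContDiff ℝ ∞ f) (x : E) (k l : ℕ) {A B : ℝ}
    (hA : ∀ i ≤ l, ‖iteratedFDeriv ℝ i c x‖ ≤ A)
    (hB : ∀ i ≤ l, ‖x‖ ^ k * ‖iteratedFDeriv ℝ i f x‖ ≤ B) :
    ‖x‖ ^ k * ‖iteratedFDeriv ℝ l (fun y ↦ c y * f y) x‖ ≤ 2 ^ l * A * B := by
  have hA0 : 0 ≤ A := (norm_nonneg _).trans (hA 0 (Nat.zero_le l))
  rcases (pow_nonneg (norm_nonneg x) k).eq_or_lt with h | h
  · have hB0 : 0 ≤ B := (by positivity : (0 : ℝ) ≤ _).trans (hB 0 (Nat.zero_le l))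
    rw [← h, zero_mul]
    positivity
  · have := norm_iteratedFDeriv_mul_le_of_le hc hf x l hA (B := B / ‖x‖ ^ k) fun i hi ↦ by
      rw [le_div_iff₀ h, mul_comm]
      exact hB i hi
    calc _ ≤ ‖x‖ ^ k * (2 ^ l * A * (B / ‖x‖ ^ k)) := by gcongr
      _ = 2 ^ l * A * B := by field_simp

end Products

/-! ### Plane waves and their derivatives -/

/-- The plane wave `x ↦ e^{-i x·η}`. -/
def planeWave (η x : RSpace n) : ℂ := Complex.exp (-Complex.I * (inner ℝ x η : ℝ))

theorem contDiff_planeWave (η : RSpace n) : ContDiff ℝ ∞ (planeWave η) :=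
  (contDiff_const.mul
    (Complex.ofRealCLM.contDiff.comp (contDiff_id.inner ℝ contDiff_const))).cexp

theorem norm_planeWave (η x : RSpace n) : ‖planeWave η x‖ = 1 := by
  have : -Complex.I * (inner ℝ x η : ℝ) = ((-inner ℝ x η : ℝ) : ℂ) * Complex.I := by
    push_cast; ring
  rw [planeWave, this, Complex.norm_exp_ofReal_mul_I]

theorem planeWave_add (η ζ x : RSpace n) :
    planeWave (η + ζ) x = planeWave η x * planeWave ζ x := by
  simp only [planeWave, inner_add_right, ← Complex.exp_add]
  push_cast
  ring_nf

theorem planeWave_comm (η x : RSpace n) : planeWave η x = planeWave x η := by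
  rw [planeWave, planeWave, real_inner_comm]

theorem iteratedDeriv_exp_neg_I (i : ℕ) :
    iteratedDeriv i (fun t : ℝ ↦ Complex.exp (-Complex.I * t)) =
      fun t : ℝ ↦ (-Complex.I) ^ i * Complex.exp (-Complex.I * t) := by
  induction i with
  | zero => simp
  | succ i ih =>
    rw [iteratedDeriv_succ, ih]
    funext t
    have h : HasDerivAt (fun t : ℝ ↦ -Complex.I * (t : ℂ)) (-Complex.I) t := by
      simpa using (Complex.ofRealCLM.hasDerivAt (x := t)).const_mul (-Complex.I)
    rw [((h.cexp).const_mul ((-Complex.I) ^ i)).deriv]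
    ring

theorem norm_iteratedFDeriv_planeWave_le (η x : RSpace n) (i : ℕ) :
    ‖iteratedFDeriv ℝ i (planeWave η) x‖ ≤ ‖η‖ ^ i := by
  have hcomp : planeWave η = (fun t : ℝ ↦ Complex.exp (-Complex.I * t)) ∘ (innerSL ℝ η) := by
    funext x
    simp [planeWave, real_inner_comm]
  have hsm : ContDiff ℝ ∞ (fun t : ℝ ↦ Complex.exp (-Complex.I * t)) :=
    (contDiff_const.mul Complex.ofRealCLM.contDiff).cexp
  rw [hcomp, (innerSL ℝ η).iteratedFDeriv_comp_right hsm x (by exact_mod_cast le_top)]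
  refine (ContinuousMultilinearMap.norm_compContinuousLinearMap_le _ _).trans ?_
  rw [norm_iteratedFDeriv_eq_norm_iteratedDeriv, iteratedDeriv_exp_neg_I, norm_mul, norm_pow,
    norm_neg, Complex.norm_I, one_pow, one_mul, Finset.prod_const, Finset.card_univ,
    Fintype.card_fin, innerSL_apply_norm]
  have := norm_planeWave η x
  rw [hcomp] at this
  exact (congrArg (· * ‖η‖ ^ i) this).le.trans (one_mul _).le

/-- The factor `‖η‖` gives continuity of modulation in the frequency. The price, one power of `1 +
‖x‖` from order zero, is paid by one further Schwartz weight. -/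
theorem norm_iteratedFDeriv_planeWave_sub_one_le {η : RSpace n} (hη : ‖η‖ ≤ 1) (x : RSpace n)
    (i : ℕ) : ‖iteratedFDeriv ℝ i (fun y ↦ planeWave η y - 1) x‖ ≤ ‖η‖ * (1 + ‖x‖) := by
  rcases i.eq_zero_or_pos with rfl | hi
  · have h : -Complex.I * (inner ℝ x η : ℝ) = Complex.I * ((-inner ℝ x η : ℝ) : ℂ) := by
      push_cast; ring
    rw [norm_iteratedFDeriv_zero, planeWave, h]
    refine Real.norm_exp_I_mul_ofReal_sub_one_le.trans ?_
    rw [norm_neg]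
    have := norm_inner_le_norm (𝕜 := ℝ) x η
    nlinarith [norm_nonneg η]
  · have h : iteratedFDeriv ℝ i (fun y ↦ planeWave η y - 1) x =
        iteratedFDeriv ℝ i (planeWave η) x := by
      have := iteratedFDeriv_sub_apply (𝕜 := ℝ) (i := i) (x := x) (f := planeWave η)
        (g := fun _ ↦ (1 : ℂ)) ((contDiff_planeWave η).of_le (by exact_mod_cast le_top)).contDiffAt
        contDiff_const.contDiffAt
      rw [iteratedFDeriv_const_of_ne hi.ne'] at this
      rw [Pi.zero_apply, sub_zero] at this
      exact this
    rw [h]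
    calc _ ≤ ‖η‖ ^ i := norm_iteratedFDeriv_planeWave_le η x i
      _ ≤ ‖η‖ := pow_le_of_le_one (norm_nonneg _) hη hi.ne'
      _ ≤ _ := by nlinarith [norm_nonneg η, norm_nonneg x, mul_nonneg (norm_nonneg η) (norm_nonneg x)]

/-! ### Modulated cutoffs: growth, continuity, superposition -/

section Modulate

variable {φ : RSpace n → ℂ} (hc : HasCompactSupport φ) (hs : ContDiff ℝ ∞ φ)

theorem modulate_apply (η x : RSpace n) : modulate φ hc hs η x = planeWave η x * φ x := rfl

theorem seminorm_modulate_le (k l : ℕ) : ∃ C, 0 ≤ C ∧ ∀ η,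
    SchwartzMap.seminorm ℝ k l (modulate φ hc hs η) ≤ C * (1 + ‖η‖) ^ l := by
  let f := hc.toSchwartzMap hs
  let S := ∑ i ∈ Finset.range (l + 1), SchwartzMap.seminorm ℝ k i f
  refine ⟨2 ^ l * S, by positivity, fun η ↦ ?_⟩
  refine SchwartzMap.seminorm_le_bound _ _ _ _ (by positivity) fun x ↦ ?_
  have := pow_mul_norm_iteratedFDeriv_mul_le (contDiff_planeWave η) hs x k l
    (A := (1 + ‖η‖) ^ l) (B := S) (fun i hi ↦ ?_) fun i hi ↦ ?_
  · calc _ ≤ _ := this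
      _ = _ := by ring
  · calc _ ≤ ‖η‖ ^ i := norm_iteratedFDeriv_planeWave_le η x i
      _ ≤ (1 + ‖η‖) ^ i := by gcongr; linarith
      _ ≤ (1 + ‖η‖) ^ l := pow_le_pow_right₀ (by linarith [norm_nonneg η]) hi
  · exact (f.le_seminorm ℝ k i x).trans (Finset.single_le_sum
      (f := fun i ↦ SchwartzMap.seminorm ℝ k i f) (fun _ _ ↦ apply_nonneg _ _)
      (Finset.mem_range_succ_iff.2 hi))

theorem continuous_modulate : Continuous (modulate φ hc hs) := by
  refine continuous_iff_continuousAt.2 fun η ↦ ?_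
  rw [ContinuousAt, (schwartz_withSeminorms ℝ (RSpace n) ℂ).tendsto_nhds _ _]
  rintro ⟨k, l⟩ ε hε
  let f := modulate φ hc hs η
  let S := ∑ i ∈ Finset.range (l + 1),
    (SchwartzMap.seminorm ℝ k i f + SchwartzMap.seminorm ℝ (k + 1) i f)
  have hS : 0 ≤ S := by positivity
  have key : ∀ ζ, ‖ζ - η‖ ≤ 1 →
      SchwartzMap.seminorm ℝ k l (modulate φ hc hs ζ - f) ≤ 2 ^ l * S * ‖ζ - η‖ := by
    intro ζ hζ
    refine SchwartzMap.seminorm_le_bound _ _ _ _ (by positivity) fun x ↦ ?_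
    have hfun : (⇑(modulate φ hc hs ζ - f) : RSpace n → ℂ) =
        fun y ↦ (planeWave (ζ - η) y - 1) * f y := by
      funext y
      have : planeWave ζ y = planeWave (ζ - η) y * planeWave η y := by
        rw [← planeWave_add, sub_add_cancel]
      change planeWave ζ y * φ y - planeWave η y * φ y = _ * (planeWave η y * φ y)
      rw [this]
      ring
    rw [hfun]
    have h1 : (0 : ℝ) < 1 + ‖x‖ := by positivity
    have := pow_mul_norm_iteratedFDeriv_mul_le
      ((contDiff_planeWave (ζ - η)).sub contDiff_const) (f.smooth ⊤) x k l
      (A := ‖ζ - η‖ * (1 + ‖x‖)) (B := S / (1 + ‖x‖))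
      (fun i _ ↦ norm_iteratedFDeriv_planeWave_sub_one_le hζ x i) fun i hi ↦ ?_
    · calc _ ≤ _ := this
        _ = _ := by field_simp
    · rw [le_div_iff₀ h1]
      calc _ = ‖x‖ ^ k * ‖iteratedFDeriv ℝ i f x‖ + ‖x‖ ^ (k + 1) * ‖iteratedFDeriv ℝ i f x‖ := by
            ring
        _ ≤ SchwartzMap.seminorm ℝ k i f + SchwartzMap.seminorm ℝ (k + 1) i f :=
          add_le_add (f.le_seminorm ℝ _ _ x) (f.le_seminorm ℝ _ _ x)
        _ ≤ S := Finset.single_le_sum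
          (f := fun i ↦ SchwartzMap.seminorm ℝ k i f + SchwartzMap.seminorm ℝ (k + 1) i f)
          (fun _ _ ↦ by positivity) (Finset.mem_range_succ_iff.2 hi)
  have hδ : 0 < min 1 (ε / (2 ^ l * S + 1)) := by positivity
  filter_upwards [Metric.ball_mem_nhds η hδ] with ζ hζ
  rw [Metric.mem_ball, dist_eq_norm, lt_min_iff, lt_div_iff₀ (by positivity)] at hζ
  refine (key ζ hζ.1.le).trans_lt ?_
  nlinarith [norm_nonneg (ζ - η), hζ.2]

/-- A localised distribution has finite order, so its Fourier transform grows at most polynomially.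
This is the a priori bound wherever no decay is assumed. -/
theorem norm_apply_modulate_le (T : 𝓢'(RSpace n, ℂ)) : ∃ (M : ℕ) (C : ℝ), 0 ≤ C ∧ ∀ η,
    ‖T (modulate φ hc hs η)‖ ≤ C * (1 + ‖η‖) ^ M := by
  obtain ⟨s, C, hC0, hC⟩ := norm_temperedDistribution_le T
  choose D hD0 hD using fun i : ℕ × ℕ ↦ seminorm_modulate_le hc hs i.1 i.2
  refine ⟨s.sup Prod.snd, C * ∑ i ∈ s, D i,
    mul_nonneg hC0 (Finset.sum_nonneg fun i _ ↦ hD0 i), fun η ↦ ?_⟩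
  rw [mul_assoc]
  refine hC _ _ (mul_nonneg (Finset.sum_nonneg fun i _ ↦ hD0 i) (by positivity)) fun i hi x ↦ ?_
  calc _ ≤ _ := (modulate φ hc hs η).le_seminorm ℝ i.1 i.2 x
    _ ≤ D i * (1 + ‖η‖) ^ i.2 := hD i η
    _ ≤ _ := by
      gcongr
      · exact Finset.sum_nonneg fun i _ ↦ hD0 i
      · exact Finset.single_le_sum (f := D) (fun i _ ↦ hD0 i) hi
      · linarith [norm_nonneg η]
      · exact Finset.le_sup (f := Prod.snd) hi

theorem schwartzMap_one_add_norm_pow_mul_le (k : 𝓢(RSpace n, ℂ)) (N : ℕ) :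
    ∃ C, 0 ≤ C ∧ ∀ y, (1 + ‖y‖) ^ N * ‖k y‖ ≤ C := by
  have h (y : RSpace n) := SchwartzMap.one_add_le_sup_seminorm_apply (𝕜 := ℝ) (m := (N, 0))
    le_rfl le_rfl k y
  simp only [norm_iteratedFDeriv_zero] at h
  exact ⟨_, (by positivity : (0 : ℝ) ≤ _).trans (h 0), h⟩

theorem integrable_one_add_norm_pow_mul (k : 𝓢(RSpace n, ℂ)) (N : ℕ) :
    Integrable fun y ↦ (1 + ‖y‖) ^ N * ‖k y‖ := by
  obtain ⟨C, -, hC⟩ := schwartzMap_one_add_norm_pow_mul_le k (N + (n + 1))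
  have h := (integrable_one_add_norm (E := RSpace n) (μ := volume) (r := n + 1)
    (by simp)).const_mul C
  refine h.mono' (by fun_prop) (Filter.Eventually.of_forall fun y ↦ ?_)
  have h1 : (0 : ℝ) < 1 + ‖y‖ := by positivity
  rw [Real.norm_of_nonneg (by positivity), Real.rpow_neg h1.le, ← div_eq_mul_inv,
    le_div_iff₀ (by positivity)]
  have h2 : (1 + ‖y‖) ^ ((n : ℝ) + 1) = (1 + ‖y‖) ^ (n + 1) := by
    exact_mod_cast Real.rpow_natCast (1 + ‖y‖) (n + 1)
  rw [h2]
  calc _ = (1 + ‖y‖) ^ (N + (n + 1)) * ‖k y‖ := by ring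
    _ ≤ C := hC y

/-- The product of `φ` and a Fourier transform is a superposition of modulations of `φ`. -/
theorem apply_mul_schwartzFourier (T : 𝓢'(RSpace n, ℂ)) (k f : 𝓢(RSpace n, ℂ))
    (hf : ∀ x, f x = φ x * schwartzFourier n k x) :
    T f = ∫ y, k y * T (modulate φ hc hs y) := by
  have h := temperedDistribution_integral (μ := volume) T (f := f)
    (Φ := fun y ↦ k y • modulate φ hc hs y) (k.continuous.smul (continuous_modulate hc hs))
    (fun m l ↦ ?_) fun x ↦ ?_
  · rw [h]
    simp
  · obtain ⟨C, hC0, hC⟩ := seminorm_modulate_le hc hs m l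
    refine ((integrable_one_add_norm_pow_mul k l).const_mul C).mono'
      ((continuous_seminorm m l).comp
        (k.continuous.smul (continuous_modulate hc hs))).aestronglyMeasurable
      (Filter.Eventually.of_forall fun y ↦ ?_)
    rw [Real.norm_of_nonneg (apply_nonneg _ _)]
    have : SchwartzMap.seminorm ℝ m l (k y • modulate φ hc hs y) =
        ‖k y‖ * SchwartzMap.seminorm ℝ m l (modulate φ hc hs y) := by
      have h := map_smul_eq_mul (SchwartzMap.seminorm ℂ m l) (k y) (modulate φ hc hs y)
      simpa only [SchwartzMap.seminorm_apply] using h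
    rw [this]
    calc _ ≤ ‖k y‖ * (C * (1 + ‖y‖) ^ l) := by gcongr; exact hC y
      _ = _ := by ring
  · rw [hf, schwartzFourier_apply, ← integral_const_mul]
    congr 1
    funext y
    change φ x * (planeWave x y * k y) = k y * (planeWave y x * φ x)
    rw [planeWave_comm x y]
    ring

end Modulate

/-! ### Smoothness from the support, and Fourier inversion -/

theorem contDiff_of_contDiffAt_tsupport {E F : Type*} [NormedAddCommGroup E] [NormedSpace ℝ E]
    [NormedAddCommGroup F] [NormedSpace ℝ F] {f : E → F} {N : WithTop ℕ∞}
    (hf : ∀ x ∈ tsupport f, ContDiffAt ℝ N f x) : ContDiff ℝ N f := by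
  refine contDiff_iff_contDiffAt.2 fun x ↦ ?_
  by_cases hx : x ∈ tsupport f
  · exact hf x hx
  · exact (contDiffAt_const (c := (0 : F))).congr_of_eventuallyEq
      (notMem_tsupport_iff_eventuallyEq.1 hx)

theorem schwartzFourier_schwartzFourier (h : 𝓢(RSpace n, ℂ)) (ζ : RSpace n) :
    schwartzFourier n (schwartzFourier n h) ζ = (2 * Real.pi : ℂ) ^ n * h (-ζ) := by
  have h1 : ∀ x, schwartzFourier n h x = 𝓕 h ((2 * Real.pi)⁻¹ • x) := fun x ↦ rfl
  have hpi : (2 * Real.pi) ≠ 0 := Real.two_pi_pos.ne'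
  rw [schwartzFourier_apply]
  simp only [h1]
  have h2 := Measure.integral_comp_smul (volume : Measure (RSpace n))
    (fun x ↦ Complex.exp (-Complex.I * (inner ℝ ((2 * Real.pi) • x) ζ : ℝ)) * 𝓕 h x)
    (2 * Real.pi)⁻¹
  simp only [smul_smul, mul_inv_cancel₀ hpi, one_smul] at h2
  rw [h2]
  have h3 : h (-ζ) = 𝓕 (⇑(𝓕 h : 𝓢(RSpace n, ℂ))) ζ := by
    have : 𝓕⁻ (𝓕 h : 𝓢(RSpace n, ℂ)) (-ζ) = h (-ζ) := by rw [FourierTransform.fourierInv_fourier_eq]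
    rw [← this, SchwartzMap.fourierInv_coe, Real.fourierInv_eq_fourier_neg, neg_neg]
  rw [h3, Real.fourier_eq']
  have h4 : ∀ x : RSpace n, Complex.exp (-Complex.I * (inner ℝ ((2 * Real.pi) • x) ζ : ℝ)) * 𝓕 h x =
      Complex.exp (↑(-2 * Real.pi * inner ℝ x ζ) * Complex.I) • 𝓕 h x := fun x ↦ by
    rw [inner_smul_left, smul_eq_mul]
    congr 2
    simp
    ring
  simp only [h4]
  rw [finrank_euclideanSpace_fin, abs_of_nonneg (by positivity), inv_pow, inv_inv,
    Complex.real_smul]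
  push_cast
  rfl

/-- The reflection `x ↦ -x` on Schwartz functions. -/
def reflect (n : ℕ) : 𝓢(RSpace n, ℂ) →L[ℂ] 𝓢(RSpace n, ℂ) :=
  SchwartzMap.compCLMOfContinuousLinearEquiv ℂ (ContinuousLinearEquiv.neg ℝ)

theorem reflect_apply (f : 𝓢(RSpace n, ℂ)) (x : RSpace n) : reflect n f x = f (-x) := rfl

theorem schwartzFourier_surjective : Function.Surjective (schwartzFourier n) := fun f ↦ by
  refine ⟨schwartzFourier n (((2 * Real.pi : ℂ) ^ n)⁻¹ • reflect n f), ?_⟩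
  ext x
  have : (2 * Real.pi : ℂ) ^ n ≠ 0 := pow_ne_zero _ (by exact_mod_cast Real.two_pi_pos.ne')
  rw [schwartzFourier_schwartzFourier, smul_apply, reflect_apply, neg_neg, smul_eq_mul,
    mul_inv_cancel_left₀ this]

/-! ### Conic neighbourhoods and change of the cutoff -/

/-- The conic neighbourhood of radius `ε` of a direction `θ`. -/
def coneNhd (θ : RSpace n) (ε : ℝ) : Set (RSpace n) := {y | ‖y - ‖y‖ • θ‖ < ε * ‖y‖}

/-- Decay faster than every power of `|y|` on a set. -/
def RapidDecayOn (f : RSpace n → ℂ) (S : Set (RSpace n)) : Prop :=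
  ∀ N : ℕ, ∃ C, 0 ≤ C ∧ ∀ y ∈ S, (1 + ‖y‖) ^ N * ‖f y‖ ≤ C

theorem IsMicrolocallySmoothAt.exists_rapidDecayOn {v : 𝓢'(RSpace n, ℂ)} {x : RSpace n}
    {θ : USphere n} (h : IsMicrolocallySmoothAt v x θ) :
    ∃ (φ : RSpace n → ℂ) (hc : HasCompactSupport φ) (hs : ContDiff ℝ ∞ φ), φ x ≠ 0 ∧
      ∃ ε, 0 < ε ∧ ε ≤ 1 ∧ RapidDecayOn (fun y ↦ v (modulate φ hc hs y)) (coneNhd θ ε) := by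
  obtain ⟨φ, hc, hs, hx, U, hU, hN⟩ := h
  obtain ⟨ε, hε, hεU⟩ := Metric.mem_nhds_iff.1 hU
  refine ⟨φ, hc, hs, hx, min ε 1, by positivity, min_le_right _ _, fun N ↦ ?_⟩
  obtain ⟨C, hC⟩ := hN N
  refine ⟨|C|, abs_nonneg _, fun y hy ↦ ?_⟩
  have hy' : ‖y - ‖y‖ • (θ : RSpace n)‖ < min ε 1 * ‖y‖ := hy
  have hy0 : 0 < ‖y‖ := by
    by_contra h0
    have : ‖y‖ = 0 := le_antisymm (not_lt.1 h0) (norm_nonneg _)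
    rw [this, mul_zero] at hy'
    exact absurd hy' (not_lt.2 (norm_nonneg _))
  have hmem : ‖y‖⁻¹ • y ∈ Metric.sphere (0 : RSpace n) 1 := by
    rw [mem_sphere_zero_iff_norm, norm_smul, norm_inv, norm_norm, inv_mul_cancel₀ hy0.ne']
  have hb : (⟨‖y‖⁻¹ • y, hmem⟩ : USphere n) ∈ U := by
    refine hεU ?_
    rw [Metric.mem_ball, Subtype.dist_eq, dist_eq_norm]
    have : ‖y‖⁻¹ • y - (θ : RSpace n) = ‖y‖⁻¹ • (y - ‖y‖ • (θ : RSpace n)) := by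
      rw [smul_sub, inv_smul_smul₀ hy0.ne']
    change ‖‖y‖⁻¹ • y - (θ : RSpace n)‖ < ε
    rw [this, norm_smul, norm_inv, norm_norm, inv_mul_lt_iff₀ hy0, mul_comm]
    exact hy'.trans_le (by gcongr; exact min_le_left _ _)
  have := hC _ hb ‖y‖ hy0
  rw [smul_inv_smul₀ hy0.ne', le_div_iff₀ (by positivity), mul_comm] at this
  exact this.trans (le_abs_self C)

/-- The deviation from the axis grows by at most 2|y|, to less than (ε/2 + ε/4)|η|, while ε|η + y|
is still at least (7/8)ε|η|. -/
theorem add_mem_coneNhd {θ : RSpace n} (hθ : ‖θ‖ = 1) {ε : ℝ} (hε : 0 < ε) (hε1 : ε ≤ 1)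
    {η y : RSpace n} (hη : η ∈ coneNhd θ (ε / 2)) (hy : ‖y‖ ≤ ε / 8 * ‖η‖) :
    η + y ∈ coneNhd θ ε := by
  have hη' : ‖η - ‖η‖ • θ‖ < ε / 2 * ‖η‖ := hη
  have h1 : ‖η‖ - ‖y‖ ≤ ‖η + y‖ := by
    have := norm_sub_le (η + y) y
    rw [add_sub_cancel_right] at this
    linarith
  have h2 : |‖η‖ - ‖η + y‖| ≤ ‖y‖ := by
    have := abs_norm_sub_norm_le η (η + y)
    simpa using this
  have h3 : η + y - ‖η + y‖ • θ = (η - ‖η‖ • θ) + y + (‖η‖ - ‖η + y‖) • θ := by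
    rw [sub_smul]; abel
  change ‖η + y - ‖η + y‖ • θ‖ < ε * ‖η + y‖
  have h4 : ‖(‖η‖ - ‖η + y‖) • θ‖ ≤ ‖y‖ := by rwa [norm_smul, hθ, mul_one]
  rw [h3]
  have h5 := norm_add₃_le (a := η - ‖η‖ • θ) (b := y) (c := (‖η‖ - ‖η + y‖) • θ)
  have h6 : ε * (‖η‖ - ‖y‖) ≤ ε * ‖η + y‖ := by gcongr
  have h7 : ε * ‖y‖ ≤ ‖y‖ := mul_le_of_le_one_left (norm_nonneg _) hε1
  have h8 : 0 ≤ ε * ‖η‖ := by positivity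
  linarith

/-- Multiplication of the cutoff by a smooth function preserves rapid decay, on a smaller cone. -/
theorem rapidDecayOn_modulate_mul (T : 𝓢'(RSpace n, ℂ)) {φ m : RSpace n → ℂ}
    (hc : HasCompactSupport φ) (hs : ContDiff ℝ ∞ φ) (hmc : HasCompactSupport m)
    (hms : ContDiff ℝ ∞ m) {θ : RSpace n} (hθ : ‖θ‖ = 1) {ε : ℝ} (hε : 0 < ε) (hε1 : ε ≤ 1)
    (h : RapidDecayOn (fun y ↦ T (modulate φ hc hs y)) (coneNhd θ ε)) :
    RapidDecayOn (fun y ↦ T (modulate (fun x ↦ φ x * m x) hmc.mul_left (hs.mul hms) y))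
      (coneNhd θ (ε / 2)) := by
  intro N
  obtain ⟨k, hk⟩ := schwartzFourier_surjective (hmc.toSchwartzMap hms)
  obtain ⟨M, B, hB0, hB⟩ := norm_apply_modulate_le hc hs T
  obtain ⟨D, hD0, hD⟩ := h N
  -- Since m = Fk, multiplication by m averages F(φT) over translates with the Schwartz weight k.
  have hrep : ∀ η, T (modulate (fun x ↦ φ x * m x) hmc.mul_left (hs.mul hms) η) =
      ∫ y, k y * T (modulate φ hc hs (η + y)) := fun η ↦ by
    rw [apply_mul_schwartzFourier (φ := fun x ↦ planeWave η x * φ x) hc.mul_left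
      ((contDiff_planeWave η).mul hs) T k _ fun x ↦ by
        rw [modulate_apply, hk, HasCompactSupport.toSchwartzMap_toFun, mul_assoc]]
    congr 1
    funext y
    congr 2
    ext x
    rw [modulate_apply, modulate_apply, planeWave_add]
    ring
  let A := 2 ^ N * D + B * (8 / ε) ^ (N + M)
  have hA : 0 ≤ A := by positivity
  have key : ∀ η ∈ coneNhd θ (ε / 2), ∀ y, (1 + ‖η‖) ^ N * ‖T (modulate φ hc hs (η + y))‖ ≤
      A * (1 + ‖y‖) ^ (N + 2 * M) := by
    intro η hη y
    have hy1 : (1 : ℝ) ≤ (1 + ‖y‖) ^ (N + 2 * M) :=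
      one_le_pow₀ (by linarith [norm_nonneg y])
    -- For small y the point η + y stays in the larger cone, where F(φT) decays. Otherwise |η| is
    -- controlled by |y|, and polynomial growth of F(φT) is absorbed by the decay of k.
    rcases le_total ‖y‖ (ε / 8 * ‖η‖) with hy | hy
    · have hmem := add_mem_coneNhd hθ hε hε1 hη hy
      have h1 : 1 + ‖η‖ ≤ 2 * (1 + ‖η + y‖) := by
        have := norm_sub_le (η + y) y
        rw [add_sub_cancel_right] at this
        nlinarith [norm_nonneg η]
      calc _ ≤ (2 * (1 + ‖η + y‖)) ^ N * ‖T (modulate φ hc hs (η + y))‖ := by gcongr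
        _ = 2 ^ N * ((1 + ‖η + y‖) ^ N * ‖T (modulate φ hc hs (η + y))‖) := by
          rw [mul_pow]; ring
        _ ≤ 2 ^ N * D := by gcongr; exact hD _ hmem
        _ ≤ A := le_add_of_nonneg_right (by positivity)
        _ ≤ _ := le_mul_of_one_le_right hA hy1
    · have h1 : 1 + ‖η‖ ≤ 8 / ε * (1 + ‖y‖) := by
        rw [div_mul_eq_mul_div, le_div_iff₀ hε]
        nlinarith
      have h2 : 1 + ‖η + y‖ ≤ (1 + ‖η‖) * (1 + ‖y‖) := by
        nlinarith [norm_add_le η y, mul_nonneg (norm_nonneg η) (norm_nonneg y)]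
      calc _ ≤ (1 + ‖η‖) ^ N * (B * (1 + ‖η + y‖) ^ M) := by gcongr; exact hB _
        _ ≤ (1 + ‖η‖) ^ N * (B * ((1 + ‖η‖) * (1 + ‖y‖)) ^ M) := by gcongr
        _ = B * (1 + ‖η‖) ^ (N + M) * (1 + ‖y‖) ^ M := by rw [mul_pow, pow_add]; ring
        _ ≤ B * (8 / ε * (1 + ‖y‖)) ^ (N + M) * (1 + ‖y‖) ^ M := by gcongr
        _ = B * (8 / ε) ^ (N + M) * (1 + ‖y‖) ^ (N + 2 * M) := by
          rw [mul_pow, two_mul, ← add_assoc, pow_add _ (N + M) M]; ring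
        _ ≤ _ := by gcongr; exact le_add_of_nonneg_left (by positivity)
  refine ⟨A * ∫ y, (1 + ‖y‖) ^ (N + 2 * M) * ‖k y‖,
    mul_nonneg hA (integral_nonneg fun y ↦ by positivity), fun η hη ↦ ?_⟩
  simp only [hrep]
  rw [← integral_const_mul]
  have hnorm : (1 + ‖η‖) ^ N * ‖∫ y, k y * T (modulate φ hc hs (η + y))‖ =
      ‖∫ y, ((1 + ‖η‖) ^ N : ℝ) • (k y * T (modulate φ hc hs (η + y)))‖ := by
    rw [integral_smul, norm_smul, Real.norm_of_nonneg (by positivity)]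
  rw [hnorm]
  refine norm_integral_le_of_norm_le ((integrable_one_add_norm_pow_mul k _).const_mul A)
    (Filter.Eventually.of_forall fun y ↦ ?_)
  rw [norm_smul, norm_mul, Real.norm_of_nonneg (by positivity)]
  calc _ = (1 + ‖η‖) ^ N * ‖T (modulate φ hc hs (η + y))‖ * ‖k y‖ := by ring
    _ ≤ A * (1 + ‖y‖) ^ (N + 2 * M) * ‖k y‖ :=
      mul_le_mul_of_nonneg_right (key η hη y) (norm_nonneg _)
    _ = _ := by ring

/-- In the definition of microlocal smoothness at `0`, the cutoff can be taken equal to `1`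
near `0`. -/
theorem IsMicrolocallySmoothAt.exists_cutoff {v : 𝓢'(RSpace n, ℂ)} {θ : USphere n}
    (h : IsMicrolocallySmoothAt v 0 θ) :
    ∃ (κ : RSpace n → ℂ) (hc : HasCompactSupport κ) (hs : ContDiff ℝ ∞ κ),
      (∃ δ, 0 < δ ∧ ∀ x, ‖x‖ < δ → κ x = 1) ∧
      ∃ ε, 0 < ε ∧ ε ≤ 1 ∧ RapidDecayOn (fun y ↦ v (modulate κ hc hs y)) (coneNhd θ ε) := by
  obtain ⟨φ, hc, hs, h0, ε, hε, hε1, hdec⟩ := h.exists_rapidDecayOn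
  obtain ⟨δ, hδ, hball⟩ := Metric.nhds_basis_closedBall.mem_iff.1
    (hs.continuous.continuousAt.eventually_ne h0)
  let b : ContDiffBump (0 : RSpace n) := ⟨δ / 2, δ, by positivity, by linarith⟩
  let κ : RSpace n → ℂ := fun x ↦ (b x : ℂ)
  have hκs : ContDiff ℝ ∞ κ := Complex.ofRealCLM.contDiff.comp b.contDiff
  have hκt : tsupport κ ⊆ Metric.closedBall 0 δ := by
    refine (closure_minimal (fun x hx ↦ ?_) Metric.isClosed_closedBall : tsupport κ ⊆ _)
    have : x ∈ Function.support b := fun hx' ↦ hx (by simp [κ, hx'])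
    rw [b.support_eq] at this
    exact Metric.ball_subset_closedBall this
  -- Here φ is nonzero on the support of κ, so m is smooth and φm = κ.
  let m : RSpace n → ℂ := fun x ↦ κ x * (φ x)⁻¹
  have hκc : HasCompactSupport κ :=
    (isCompact_closedBall (0 : RSpace n) δ).of_isClosed_subset isClosed_closure hκt
  have hmc : HasCompactSupport m := hκc.mul_right
  have hms : ContDiff ℝ ∞ m := by
    refine contDiff_of_contDiffAt_tsupport fun x hx ↦ ?_
    have hx' : x ∈ tsupport κ := tsupport_mul_subset_left hx
    exact hκs.contDiffAt.mul (hs.contDiffAt.inv (hball (hκt hx')))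
  have hmul : (fun x ↦ φ x * m x) = κ := by
    funext x
    by_cases hx : x ∈ tsupport κ
    · have : φ x ≠ 0 := hball (hκt hx)
      simp only [m]
      field_simp
    · simp [m, image_eq_zero_of_notMem_tsupport hx]
  have := rapidDecayOn_modulate_mul v hc hs hmc hms (mem_sphere_zero_iff_norm.1 θ.2) hε hε1 hdec
  refine ⟨fun x ↦ φ x * m x, hmc.mul_left, hs.mul hms, ⟨δ / 2, by positivity, fun x hx ↦ ?_⟩,
    ε / 2, by positivity, by linarith, this⟩
  have h1 : κ x = φ x * m x := (congrFun hmul x).symm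
  have h2 : b x = 1 := b.one_of_mem_closedBall (by simpa using hx.le)
  simp only [← h1, κ, h2, Complex.ofReal_one]

/-! ### Decay of T on Fourier transforms of parabolically scaled functions -/

/-- The scaling `f ↦ f (c ·)` of Schwartz functions. -/
def scaleCLM (n : ℕ) {c : ℝ} (hc : c ≠ 0) : 𝓢(RSpace n, ℂ) →L[ℂ] 𝓢(RSpace n, ℂ) :=
  SchwartzMap.compCLMOfContinuousLinearEquiv ℂ
    (ContinuousLinearEquiv.smulLeft (Units.mk0 c hc))

theorem scaleCLM_apply {c : ℝ} (hc : c ≠ 0) (f : 𝓢(RSpace n, ℂ)) (x : RSpace n) :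
    scaleCLM n hc f x = f (c • x) := rfl

theorem schwartzFourier_scaleCLM {c : ℝ} (hc : 0 < c) (f : 𝓢(RSpace n, ℂ)) (x : RSpace n) :
    schwartzFourier n (scaleCLM n hc.ne' f) x = (c⁻¹ : ℂ) ^ n * schwartzFourier n f (c⁻¹ • x) := by
  rw [schwartzFourier_apply, schwartzFourier_apply]
  have h := Measure.integral_comp_smul (volume : Measure (RSpace n))
    (fun y ↦ Complex.exp (-Complex.I * (inner ℝ y (c⁻¹ • x) : ℝ)) * f y) c
  have h2 : ∀ y : RSpace n, inner ℝ (c • y) (c⁻¹ • x) = inner ℝ y x := fun y ↦ by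
    rw [real_inner_smul_left, real_inner_smul_right, mul_inv_cancel_left₀ hc.ne']
  simp only [h2] at h
  simp only [scaleCLM_apply]
  rw [h, finrank_euclideanSpace_fin, abs_of_nonneg (by positivity), Complex.real_smul]
  push_cast
  rw [inv_pow]

theorem integral_le_of_eq_zero_off_closedBall {f : RSpace n → ℝ} {R B : ℝ}
    (h0 : ∀ x, R < ‖x‖ → f x = 0) (hf0 : ∀ x, 0 ≤ f x) (hB : ∀ x, f x ≤ B) :
    ∫ x, f x ≤ B * (volume : Measure (RSpace n)).real (Metric.closedBall 0 R) := by
  rw [← setIntegral_eq_integral_of_forall_compl_eq_zero (s := Metric.closedBall 0 R) fun x hx ↦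
    h0 x (by simpa using hx)]
  refine (le_abs_self _).trans ?_
  exact norm_setIntegral_le_of_norm_le_const (μ := volume) measure_closedBall_lt_top fun x _ ↦ by
    rw [Real.norm_of_nonneg (hf0 x)]; exact hB x

theorem iteratedFDeriv_eq_zero_of_lt_norm {f : RSpace n → ℂ} {R : ℝ}
    (h0 : ∀ x, R < ‖x‖ → f x = 0) {x : RSpace n} (hx : R < ‖x‖) (i : ℕ) :
    iteratedFDeriv ℝ i f x = 0 := by
  have : f =ᶠ[𝓝 x] fun _ ↦ 0 := by
    filter_upwards [(isOpen_lt continuous_const continuous_norm).mem_nhds hx] with y hy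
    exact h0 y hy
  rw [(this.iteratedFDeriv ℝ i).eq_of_nhds]
  simp

/-- Bound for the Fourier transform of a function supported in a ball, with control of the number
of derivatives. -/
theorem pow_mul_norm_iteratedFDeriv_schwartzFourier_le (n K j : ℕ) (R : ℝ) (hR : 0 ≤ R) :
    ∃ C, 0 ≤ C ∧ ∀ (f : 𝓢(RSpace n, ℂ)) (B : ℝ), (∀ x, R < ‖x‖ → f x = 0) →
      (∀ q ≤ K, ∀ x, ‖iteratedFDeriv ℝ q f x‖ ≤ B) →
      ∀ x, ‖x‖ ^ K * ‖iteratedFDeriv ℝ j (schwartzFourier n f) x‖ ≤ C * B := by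
  let V := (volume : Measure (RSpace n)).real (Metric.closedBall 0 R)
  have hV : 0 ≤ V := measureReal_nonneg
  let S := ∑ p ∈ Finset.range (j + 1) ×ˢ Finset.range (K + 1), R ^ p.1 * V
  have hS : 0 ≤ S := Finset.sum_nonneg fun p _ ↦ by positivity
  have hpi := Real.two_pi_pos
  refine ⟨(2 * Real.pi) ^ K * ((2 * j + 2) ^ K * S), by positivity, fun f B h0 hB x ↦ ?_⟩
  have hB0 : 0 ≤ B := (norm_nonneg _).trans (hB 0 (Nat.zero_le _) 0)
  have hcomp : (⇑(schwartzFourier n f)) = fun x ↦ (𝓕 (f : RSpace n → ℂ)) ((2 * Real.pi)⁻¹ • x) :=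
    rfl
  have hsm : ContDiff ℝ j (𝓕 (f : RSpace n → ℂ)) := by
    rw [← SchwartzMap.fourier_coe]
    exact (𝓕 f : 𝓢(RSpace n, ℂ)).smooth j
  have hF := Real.pow_mul_norm_iteratedFDeriv_fourier_le (K := ⊤) (N := ⊤) (f.smooth ⊤)
    (fun k l _ _ ↦ f.integrable_pow_mul_iteratedFDeriv volume k l) (k := j) (n := K) le_top le_top
    ((2 * Real.pi)⁻¹ • x)
  have hsum : ∑ p ∈ Finset.range (j + 1) ×ˢ Finset.range (K + 1),
      ∫ v, ‖v‖ ^ p.1 * ‖iteratedFDeriv ℝ p.2 f v‖ ≤ S * B := by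
    rw [Finset.sum_mul]
    refine Finset.sum_le_sum fun p hp ↦ ?_
    have hp2 : p.2 ≤ K := Finset.mem_range_succ_iff.1 (Finset.mem_product.1 hp).2
    have := integral_le_of_eq_zero_off_closedBall (R := R) (B := R ^ p.1 * B)
      (f := fun v : RSpace n ↦ ‖v‖ ^ p.1 * ‖iteratedFDeriv ℝ p.2 f v‖)
      (fun v hv ↦ by simp only [iteratedFDeriv_eq_zero_of_lt_norm h0 hv, norm_zero, mul_zero])
      (fun v ↦ by positivity) fun v ↦ by
        rcases lt_or_ge R ‖v‖ with hv | hv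
        · simp only [iteratedFDeriv_eq_zero_of_lt_norm h0 hv, norm_zero, mul_zero]
          positivity
        · gcongr
          exact hB _ hp2 v
    calc _ ≤ _ := this
      _ = R ^ p.1 * V * B := by ring
  rw [hcomp, iteratedFDeriv_comp_const_smul _ hsm]
  simp only [norm_smul, norm_pow, norm_inv, Real.norm_of_nonneg hpi.le] at hF ⊢
  have h1 : ‖x‖ ^ K = (2 * Real.pi) ^ K * ((2 * Real.pi)⁻¹ * ‖x‖) ^ K := by
    rw [← mul_pow, mul_inv_cancel_left₀ hpi.ne']
  rw [h1]
  calc _ = (2 * Real.pi) ^ K * ((2 * Real.pi)⁻¹ ^ j * (((2 * Real.pi)⁻¹ * ‖x‖) ^ K *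
        ‖iteratedFDeriv ℝ j (𝓕 (f : RSpace n → ℂ)) ((2 * Real.pi)⁻¹ • x)‖)) := by ring
    _ ≤ (2 * Real.pi) ^ K * ((2 * Real.pi)⁻¹ ^ j *
        ((2 * Real.pi) ^ j * (2 * j + 2) ^ K * (S * B))) := by
      refine mul_le_mul_of_nonneg_left (mul_le_mul_of_nonneg_left (hF.trans ?_) (by positivity))
        (by positivity)
      gcongr
    _ = (2 * Real.pi) ^ K * ((2 * j + 2) ^ K * S) * B := by
      have : (2 * Real.pi)⁻¹ ^ j * (2 * Real.pi) ^ j = 1 := by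
        rw [← mul_pow, inv_mul_cancel₀ hpi.ne', one_pow]
      linear_combination ((2 * Real.pi) ^ K * (2 * j + 2) ^ K * S * B) * this

theorem exists_bound_iteratedFDeriv {F : Type*} [NormedAddCommGroup F] [NormedSpace ℝ F]
    {a : RSpace n → F} (hc : HasCompactSupport a)
    (hs : ContDiff ℝ ∞ a) (l : ℕ) : ∃ A, 1 ≤ A ∧ ∀ i ≤ l, ∀ x, ‖iteratedFDeriv ℝ i a x‖ ≤ A := by
  let f := hc.toSchwartzMap hs
  refine ⟨1 + ∑ i ∈ Finset.range (l + 1), SchwartzMap.seminorm ℝ 0 i f,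
    le_add_of_nonneg_right (by positivity), fun i hi x ↦ ?_⟩
  calc _ ≤ SchwartzMap.seminorm ℝ 0 i f := SchwartzMap.norm_iteratedFDeriv_le_seminorm ℝ f i x
    _ ≤ ∑ i ∈ Finset.range (l + 1), SchwartzMap.seminorm ℝ 0 i f :=
      Finset.single_le_sum (f := fun i ↦ SchwartzMap.seminorm ℝ 0 i f)
        (fun _ _ ↦ apply_nonneg _ _) (Finset.mem_range_succ_iff.2 hi)
    _ ≤ _ := by linarith

theorem norm_iteratedFDeriv_one_sub_le {a : RSpace n → ℂ} (hs : ContDiff ℝ ∞ a) (i : ℕ)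
    (x : RSpace n) : ‖iteratedFDeriv ℝ i (fun y ↦ 1 - a y) x‖ ≤ 1 + ‖iteratedFDeriv ℝ i a x‖ := by
  have h := iteratedFDeriv_sub_apply (𝕜 := ℝ) (i := i) (x := x) (f := fun _ ↦ (1 : ℂ)) (g := a)
    contDiff_const.contDiffAt (hs.of_le (by exact_mod_cast le_top)).contDiffAt
  change iteratedFDeriv ℝ i (fun y ↦ 1 - a y) x = _ at h
  rw [h]
  refine (norm_sub_le _ _).trans ?_
  gcongr
  rcases i.eq_zero_or_pos with rfl | hi
  · simp
  · rw [iteratedFDeriv_const_of_ne hi.ne']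
    simp

/-- Away from the origin, a Fourier transform `s^n F h(s² x)`, where the derivatives of `h` are of
size `s^q`, is rapidly decreasing in `s`. -/
theorem exists_norm_apply_one_sub_mul_le (T : 𝓢'(RSpace n, ℂ)) {κ : RSpace n → ℂ}
    (hc : HasCompactSupport κ) (hs : ContDiff ℝ ∞ κ) {δ : ℝ} (hδ : 0 < δ)
    (hκ : ∀ x, ‖x‖ < δ → κ x = 1) {R : ℝ} (hR : 0 ≤ R) (N : ℕ) :
    ∃ (K : ℕ) (C : ℝ), 0 ≤ C ∧ ∀ (s : ℝ) (B : ℝ) (h f : 𝓢(RSpace n, ℂ)), 1 ≤ s → 0 ≤ B →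
      (∀ y, R < ‖y‖ → h y = 0) → (∀ q ≤ K, ∀ y, ‖iteratedFDeriv ℝ q h y‖ ≤ B * s ^ q) →
      (∀ x, f x = (1 - κ x) * ((s : ℂ) ^ n * schwartzFourier n h (s ^ 2 • x))) →
      s ^ N * ‖T f‖ ≤ C * B := by
  obtain ⟨S, C₀, hC₀, hT⟩ := norm_temperedDistribution_le T
  let M := S.sup Prod.fst + S.sup Prod.snd
  have hM : ∀ i ∈ S, i.1 ≤ M ∧ i.2 ≤ M := fun i hi ↦
    ⟨(Finset.le_sup (f := Prod.fst) hi).trans (Nat.le_add_right _ _),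
      (Finset.le_sup (f := Prod.snd) hi).trans (Nat.le_add_left _ _)⟩
  -- L integrations by parts gain s^L net. This pays for the wanted s^N, the prefactor sⁿ, and the
  -- s^(2j), j ≤ M, from differentiating in s²x.
  let L := N + n + 2 * M
  choose D hD0 hD using fun k j : ℕ ↦
    pow_mul_norm_iteratedFDeriv_schwartzFourier_le n (k + L) j R hR
  let D' := ∑ k ∈ Finset.range (M + 1), ∑ j ∈ Finset.range (M + 1), D k j
  have hD'0 : 0 ≤ D' := Finset.sum_nonneg fun k _ ↦ Finset.sum_nonneg fun j _ ↦ hD0 k j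
  have hDle : ∀ k ≤ M, ∀ j ≤ M, D k j ≤ D' := fun k hk j hj ↦
    (Finset.single_le_sum (f := fun j ↦ D k j) (fun j _ ↦ hD0 k j)
      (Finset.mem_range_succ_iff.2 hj)).trans
    (Finset.single_le_sum (f := fun k ↦ ∑ j ∈ Finset.range (M + 1), D k j)
      (fun k _ ↦ Finset.sum_nonneg fun j _ ↦ hD0 k j) (Finset.mem_range_succ_iff.2 hk))
  obtain ⟨A, hA1, hA⟩ := exists_bound_iteratedFDeriv hc hs M
  refine ⟨M + L, C₀ * (2 ^ M * (1 + A) * (δ⁻¹ ^ L * D')), by positivity,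
    fun s B h f hs1 hB0 hsupp hder hf ↦ ?_⟩
  have hs0 : 0 < s := by linarith
  have hfun : (f : RSpace n → ℂ) =
      fun x ↦ (1 - κ x) * ((s : ℂ) ^ n * schwartzFourier n h (s ^ 2 • x)) := funext hf
  rw [← le_div_iff₀' (by positivity)]
  refine (hT f (2 ^ M * (1 + A) * (δ⁻¹ ^ L * D') * B / s ^ N) (by positivity)
    fun i hi x ↦ ?_).trans_eq (by ring)
  obtain ⟨hk, hl⟩ := hM i hi
  rcases lt_or_ge ‖x‖ δ with hx | hx
  · have : (f : RSpace n → ℂ) =ᶠ[𝓝 x] fun _ ↦ 0 := by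
      filter_upwards [(isOpen_lt continuous_norm continuous_const).mem_nhds hx] with y hy
      rw [hf, hκ y hy, sub_self, zero_mul]
    rw [(this.iteratedFDeriv ℝ i.2).eq_of_nhds]
    simp only [iteratedFDeriv_fun_zero, Pi.zero_apply, norm_zero, mul_zero]
    positivity
  · let G := schwartzFourier n h
    have hG1 : ContDiff ℝ ∞ fun x ↦ G (s ^ 2 • x) :=
      (G.smooth ⊤).comp (contDiff_const_smul (s ^ 2))
    have hder2 : ∀ j ≤ i.2, ‖x‖ ^ i.1 * ‖iteratedFDeriv ℝ j
        (fun x ↦ (s : ℂ) ^ n * G (s ^ 2 • x)) x‖ ≤ δ⁻¹ ^ L * D' * B / s ^ N := by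
      intro j hj
      have hjM := hj.trans hl
      have h1 : iteratedFDeriv ℝ j (fun x ↦ (s : ℂ) ^ n * G (s ^ 2 • x)) x =
          (s : ℂ) ^ n • ((s ^ 2) ^ j • iteratedFDeriv ℝ j G (s ^ 2 • x)) := by
        have h2 := iteratedFDeriv_const_smul_apply (𝕜 := ℝ) (i := j) (x := x) (a := (s : ℂ) ^ n)
          (f := fun x ↦ G (s ^ 2 • x)) (hG1.of_le (by exact_mod_cast le_top)).contDiffAt
        rw [iteratedFDeriv_comp_const_smul _ (G.smooth j)] at h2
        exact h2
      have h3 : ∀ q ≤ i.1 + L, ∀ y, ‖iteratedFDeriv ℝ q h y‖ ≤ B * s ^ (i.1 + L) :=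
        fun q hq y ↦ (hder q (hq.trans (by omega)) y).trans (by gcongr)
      have h4 := hD i.1 j h _ hsupp h3 (s ^ 2 • x)
      -- On |x| ≥ δ the extra weight |x|^L, needed to match the decay of F h, can be inserted at the
      -- cost of δ^(-L).
      have h5 : (1 : ℝ) ≤ (δ⁻¹ * ‖x‖) ^ L := one_le_pow₀ (by
        rw [inv_mul_eq_div, one_le_div hδ]; exact hx)
      rw [h1, norm_smul, norm_smul, norm_pow, norm_pow, Complex.norm_real,
        Real.norm_of_nonneg hs0.le, norm_pow, Real.norm_of_nonneg hs0.le]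
      rw [norm_smul, norm_pow, Real.norm_of_nonneg hs0.le, mul_pow] at h4
      rw [le_div_iff₀ (by positivity)]
      have h6 : s ^ (n + 2 * j + N + i.1 + L) ≤ s ^ (2 * (i.1 + L)) :=
        pow_le_pow_right₀ hs1 (by simp only [L]; omega)
      have h7 : 0 < s ^ (i.1 + L) := by positivity
      refine le_of_mul_le_mul_right ?_ h7
      calc ‖x‖ ^ i.1 * (s ^ n * ((s ^ 2) ^ j * ‖iteratedFDeriv ℝ j G (s ^ 2 • x)‖)) * s ^ N *
            s ^ (i.1 + L)
          = ‖x‖ ^ i.1 * ‖iteratedFDeriv ℝ j G (s ^ 2 • x)‖ * s ^ (n + 2 * j + N + i.1 + L) := by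
            ring
        _ ≤ ‖x‖ ^ i.1 * ‖iteratedFDeriv ℝ j G (s ^ 2 • x)‖ * s ^ (2 * (i.1 + L)) * 1 := by
            rw [mul_one]; gcongr
        _ ≤ ‖x‖ ^ i.1 * ‖iteratedFDeriv ℝ j G (s ^ 2 • x)‖ * s ^ (2 * (i.1 + L)) *
            (δ⁻¹ * ‖x‖) ^ L := by gcongr
        _ = δ⁻¹ ^ L * ((s ^ 2) ^ (i.1 + L) * ‖x‖ ^ (i.1 + L) *
            ‖iteratedFDeriv ℝ j G (s ^ 2 • x)‖) := by ring
        _ ≤ δ⁻¹ ^ L * (D i.1 j * (B * s ^ (i.1 + L))) := by gcongr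
        _ ≤ δ⁻¹ ^ L * (D' * (B * s ^ (i.1 + L))) := by gcongr; exact hDle _ hk _ hjM
        _ = δ⁻¹ ^ L * D' * B * s ^ (i.1 + L) := by ring
    have := pow_mul_norm_iteratedFDeriv_mul_le (contDiff_const.sub hs) (contDiff_const.mul hG1) x
      i.1 i.2 (A := 1 + A) (fun j hj ↦ (norm_iteratedFDeriv_one_sub_le hs j x).trans
        (add_le_add_right (hA j (hj.trans hl) x) 1)) hder2
    rw [hfun]
    calc _ ≤ _ := this
      _ ≤ 2 ^ M * (1 + A) * (δ⁻¹ ^ L * D' * B / s ^ N) := by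
        gcongr
        norm_num
      _ = _ := by ring

/-- The scaling `y ↦ s⁻ⁿ h(s⁻² y)`. -/
def parabolicScale (n : ℕ) {s : ℝ} (hs : 0 < s) : 𝓢(RSpace n, ℂ) →L[ℂ] 𝓢(RSpace n, ℂ) :=
  ((s : ℂ) ^ n)⁻¹ • scaleCLM n (inv_pos.2 (pow_pos hs 2)).ne'

theorem parabolicScale_apply {s : ℝ} (hs : 0 < s) (h : 𝓢(RSpace n, ℂ)) (y : RSpace n) :
    parabolicScale n hs h y = ((s : ℂ) ^ n)⁻¹ * h ((s ^ 2)⁻¹ • y) := rfl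

theorem schwartzFourier_parabolicScale {s : ℝ} (hs : 0 < s) (h : 𝓢(RSpace n, ℂ)) (x : RSpace n) :
    schwartzFourier n (parabolicScale n hs h) x =
      (s : ℂ) ^ n * schwartzFourier n h (s ^ 2 • x) := by
  have h1 : schwartzFourier n (parabolicScale n hs h) x = ((s : ℂ) ^ n)⁻¹ *
      schwartzFourier n (scaleCLM n (inv_pos.2 (pow_pos hs 2)).ne' h) x := by
    rw [parabolicScale, smul_apply, map_smul, smul_apply, smul_eq_mul]
  have h2 : (s : ℂ) ≠ 0 := by exact_mod_cast hs.ne'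
  rw [h1, schwartzFourier_scaleCLM (inv_pos.2 (pow_pos hs 2)), inv_inv]
  push_cast
  rw [inv_inv]
  field_simp
  ring

theorem mem_coneNhd_of_near {θ : RSpace n} (hθ : ‖θ‖ = 1) {ε : ℝ} (hε : 0 < ε) (hε1 : ε ≤ 1)
    {y : RSpace n} (hy : ‖y - θ‖ ≤ ε / 8) : 1 / 2 ≤ ‖y‖ ∧ ‖y‖ ≤ 2 ∧ y ∈ coneNhd θ ε := by
  have h1 : |‖y‖ - 1| ≤ ε / 8 := by
    rw [← hθ]
    exact (abs_norm_sub_norm_le y θ).trans hy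
  obtain ⟨h2, h3⟩ := abs_le.1 h1
  refine ⟨by linarith, by linarith, ?_⟩
  change ‖y - ‖y‖ • θ‖ < ε * ‖y‖
  have h4 : y - ‖y‖ • θ = (y - θ) + (1 - ‖y‖) • θ := by rw [sub_smul, one_smul]; abel
  have h5 : ‖(1 - ‖y‖) • θ‖ ≤ ε / 8 := by
    rw [norm_smul, hθ, mul_one, Real.norm_eq_abs, abs_sub_comm]
    exact h1
  rw [h4]
  refine (norm_add_le _ _).trans_lt ?_
  nlinarith

theorem smul_mem_coneNhd {θ y : RSpace n} {ε c : ℝ} (hc : 0 < c) (hy : y ∈ coneNhd θ ε) :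
    c • y ∈ coneNhd θ ε := by
  have hy' : ‖y - ‖y‖ • θ‖ < ε * ‖y‖ := hy
  change ‖c • y - ‖c • y‖ • θ‖ < ε * ‖c • y‖
  rw [norm_smul, Real.norm_of_nonneg hc.le, mul_smul, ← smul_sub, norm_smul,
    Real.norm_of_nonneg hc.le, mul_left_comm]
  gcongr

/-- The pairing is an integral of the scaled h against F(κT), and the scaled h lives at size about
s² inside the cone. Only the size of h enters, not its derivatives. -/
theorem exists_norm_apply_mul_le (T : 𝓢'(RSpace n, ℂ)) {κ : RSpace n → ℂ}
    (hc : HasCompactSupport κ) (hs : ContDiff ℝ ∞ κ) {θ : RSpace n} (hθ : ‖θ‖ = 1) {ε : ℝ}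
    (hε : 0 < ε) (hε1 : ε ≤ 1)
    (hdec : RapidDecayOn (fun y ↦ T (modulate κ hc hs y)) (coneNhd θ ε)) (N : ℕ) :
    ∃ C, 0 ≤ C ∧ ∀ (s : ℝ) (B : ℝ) (h f : 𝓢(RSpace n, ℂ)) (hs0 : 0 < s), 1 ≤ s → 0 ≤ B →
      (∀ y, h y ≠ 0 → ‖y - θ‖ ≤ ε / 8) → (∀ y, ‖h y‖ ≤ B) →
      (∀ x, f x = κ x * schwartzFourier n (parabolicScale n hs0 h) x) →
      s ^ N * ‖T f‖ ≤ C * B := by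
  -- The scaled h has L¹ norm O(sⁿ), and decay of order N + n at |y| ~ s² gives s^(-2(N+n)), more
  -- than enough.
  obtain ⟨D, hD0, hD⟩ := hdec (N + n)
  let V := (volume : Measure (RSpace n)).real (Metric.closedBall 0 2)
  have hV : 0 ≤ V := measureReal_nonneg
  refine ⟨2 ^ (N + n) * D * V, by positivity, fun s B h f hs0 hs1 hB0 hsupp hB hf ↦ ?_⟩
  rw [apply_mul_schwartzFourier hc hs T _ f hf]
  have hpt : ∀ y, ‖parabolicScale n hs0 h y * T (modulate κ hc hs y)‖ ≤
      (s ^ n)⁻¹ * (2 ^ (N + n) * D * ((s ^ 2) ^ (N + n))⁻¹) * ‖h ((s ^ 2)⁻¹ • y)‖ := by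
    intro y
    rw [norm_mul, parabolicScale_apply, norm_mul, norm_inv, norm_pow, Complex.norm_real,
      Real.norm_of_nonneg hs0.le]
    rcases eq_or_ne (h ((s ^ 2)⁻¹ • y)) 0 with h0 | h0
    · simp [h0]
    · obtain ⟨h1, -, h2⟩ := mem_coneNhd_of_near hθ hε hε1 (hsupp _ h0)
      have h3 : y ∈ coneNhd θ ε := by
        have := smul_mem_coneNhd (pow_pos hs0 2) h2
        rwa [smul_inv_smul₀ (pow_pos hs0 2).ne'] at this
      have h4 : s ^ 2 ≤ 2 * (1 + ‖y‖) := by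
        rw [norm_smul, norm_inv, Real.norm_of_nonneg (by positivity), inv_mul_eq_div,
          le_div_iff₀ (by positivity)] at h1
        linarith
      have h5 : ‖T (modulate κ hc hs y)‖ ≤ 2 ^ (N + n) * D * ((s ^ 2) ^ (N + n))⁻¹ := by
        rw [← div_eq_mul_inv, le_div_iff₀ (by positivity), mul_comm]
        calc _ ≤ (2 * (1 + ‖y‖)) ^ (N + n) * ‖T (modulate κ hc hs y)‖ := by gcongr
          _ = 2 ^ (N + n) * ((1 + ‖y‖) ^ (N + n) * ‖T (modulate κ hc hs y)‖) := by
            rw [mul_pow, mul_assoc]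
          _ ≤ _ := by gcongr; exact hD y h3
      calc _ ≤ (s ^ n)⁻¹ * ‖h ((s ^ 2)⁻¹ • y)‖ * (2 ^ (N + n) * D * ((s ^ 2) ^ (N + n))⁻¹) := by
            gcongr
        _ = _ := by ring
  have hint : ∫ y, ‖h ((s ^ 2)⁻¹ • y)‖ ≤ (s ^ 2) ^ n * (B * V) := by
    have := Measure.integral_comp_smul (volume : Measure (RSpace n)) (fun y ↦ ‖h y‖) (s ^ 2)⁻¹
    rw [this, finrank_euclideanSpace_fin, abs_of_nonneg (by positivity), inv_pow, inv_inv,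
      smul_eq_mul]
    gcongr
    refine integral_le_of_eq_zero_off_closedBall (fun y hy ↦ ?_) (fun y ↦ norm_nonneg _) hB
    by_contra h0
    have := (mem_coneNhd_of_near hθ hε hε1 (hsupp y fun h ↦ h0 (by rw [h, norm_zero]))).2.1
    linarith
  have hI : Integrable fun y ↦ ‖h ((s ^ 2)⁻¹ • y)‖ :=
    (scaleCLM n (inv_pos.2 (pow_pos hs0 2)).ne' h).integrable.norm
  have h6 := norm_integral_le_of_norm_le (hI.const_mul _) (Filter.Eventually.of_forall hpt)
  rw [integral_const_mul] at h6
  have h7 : s ^ N * s ^ n ≤ s ^ N * s ^ n * s ^ N := le_mul_of_one_le_right (by positivity)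
    (one_le_pow₀ hs1)
  calc _ ≤ s ^ N * ((s ^ n)⁻¹ * (2 ^ (N + n) * D * ((s ^ 2) ^ (N + n))⁻¹) *
        ((s ^ 2) ^ n * (B * V))) := by
        gcongr
        exact h6.trans (by gcongr)
    _ = 2 ^ (N + n) * D * V * B * (s ^ n * s ^ N)⁻¹ := by
        have : s ≠ 0 := hs0.ne'
        field_simp
        ring
    _ ≤ 2 ^ (N + n) * D * V * B * 1 := by
        gcongr
        exact inv_le_one_of_one_le₀ (one_le_mul_of_one_le_of_one_le (one_le_pow₀ hs1)
          (one_le_pow₀ hs1))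
    _ = _ := by ring

/-- If `T` is microlocally smooth at `(0, θ)`, then `T` is rapidly decreasing on the Fourier
transforms of functions of size `s²` near `s² θ` which oscillate at scale `s`. -/
theorem IsMicrolocallySmoothAt.norm_apply_parabolicScale_le {T : 𝓢'(RSpace n, ℂ)} {θ : USphere n}
    (hT : IsMicrolocallySmoothAt T 0 θ) : ∃ ε, 0 < ε ∧ ε ≤ 1 ∧ ∀ N : ℕ,
      ∃ (K : ℕ) (C : ℝ), 0 ≤ C ∧ ∀ (s : ℝ) (B : ℝ) (h : 𝓢(RSpace n, ℂ)) (hs0 : 0 < s), 1 ≤ s →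
      0 ≤ B → (∀ y, h y ≠ 0 → ‖y - θ‖ ≤ ε / 8) →
      (∀ q ≤ K, ∀ y, ‖iteratedFDeriv ℝ q h y‖ ≤ B * s ^ q) →
      s ^ N * ‖T (schwartzFourier n (parabolicScale n hs0 h))‖ ≤ C * B := by
  obtain ⟨κ, hc, hs, ⟨δ, hδ, hκ⟩, ε, hε, hε1, hdec⟩ := hT.exists_cutoff
  have hθ : ‖(θ : RSpace n)‖ = 1 := mem_sphere_zero_iff_norm.1 θ.2
  refine ⟨ε, hε, hε1, fun N ↦ ?_⟩
  -- Radius 2 suffices, since h is supported within ε/8 of the unit vector θ.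
  obtain ⟨K, C₁, hC₁, h₁⟩ := exists_norm_apply_one_sub_mul_le T hc hs hδ hκ zero_le_two N
  obtain ⟨C₂, hC₂, h₂⟩ := exists_norm_apply_mul_le T hc hs hθ hε hε1 hdec N
  refine ⟨K, C₁ + C₂, by positivity, fun s B h hs0 hs1 hB hsupp hder ↦ ?_⟩
  let g := schwartzFourier n (parabolicScale n hs0 h)
  have hκg : ∀ x, SchwartzMap.smulLeftCLM ℂ κ g x = κ x * g x := fun x ↦
    SchwartzMap.smulLeftCLM_apply_apply (hc.hasTemperateGrowth hs) g x
  have e1 := h₁ s B h (g - SchwartzMap.smulLeftCLM ℂ κ g) hs1 hB (fun y hy ↦ by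
      by_contra h0
      linarith [(mem_coneNhd_of_near hθ hε hε1 (hsupp y h0)).2.1]) hder fun x ↦ by
    rw [sub_apply, hκg, ← schwartzFourier_parabolicScale hs0]
    ring
  have e2 := h₂ s B h (SchwartzMap.smulLeftCLM ℂ κ g) hs0 hs1 hB hsupp (fun y ↦ by
    simpa using hder 0 (Nat.zero_le _) y) hκg
  have e3 : T g = T (g - SchwartzMap.smulLeftCLM ℂ κ g) + T (SchwartzMap.smulLeftCLM ℂ κ g) := by
    rw [← map_add, sub_add_cancel]
  calc _ ≤ s ^ N * (‖T (g - SchwartzMap.smulLeftCLM ℂ κ g)‖ +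
        ‖T (SchwartzMap.smulLeftCLM ℂ κ g)‖) := by
        gcongr
        change ‖T g‖ ≤ _
        rw [e3]
        exact norm_add_le _ _
    _ ≤ _ := by linarith

/-! ### The packet in rescaled variables -/

section Source

variable {θ : RSpace n} (b b₂ : ContDiffBump θ)

theorem ne_zero_of_mem_tsupport_bump (hθ : ‖θ‖ = 1) (hb : b.rOut < 1) {y : RSpace n}
    (hy : y ∈ tsupport b) : y ≠ 0 := by
  rintro rfl
  rw [b.tsupport_eq, Metric.mem_closedBall, dist_eq_norm, zero_sub, norm_neg, hθ] at hy
  linarith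

/-- The amplitude `b(y) / (2 |y|^{n/2})`. -/
def amplitude (y : RSpace n) : ℝ := b y * (2 * Real.sqrt ‖y‖ ^ n)⁻¹

/-- The map `y ↦ y / √|y|`, cut off away from `θ`. -/
def rootMap (y : RSpace n) : RSpace n := b₂ y • ((Real.sqrt ‖y‖)⁻¹ • y)

theorem contDiffAt_sqrt_norm {y : RSpace n} (hy : y ≠ 0) :
    ContDiffAt ℝ ∞ (fun y : RSpace n ↦ Real.sqrt ‖y‖) y :=
  (contDiffAt_norm ℝ hy).sqrt (norm_ne_zero_iff.2 hy)

theorem contDiff_amplitude (hθ : ‖θ‖ = 1) (hb : b.rOut < 1) : ContDiff ℝ ∞ (amplitude b) := by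
  refine contDiff_of_contDiffAt_tsupport fun y hy ↦ ?_
  have hy0 := ne_zero_of_mem_tsupport_bump b hθ hb (tsupport_mul_subset_left hy)
  have : (2 * Real.sqrt ‖y‖ ^ n) ≠ 0 := by
    have := norm_pos_iff.2 hy0
    positivity
  exact b.contDiffAt.mul ((contDiffAt_const.mul ((contDiffAt_sqrt_norm hy0).pow n)).inv this)

theorem contDiff_rootMap (hθ : ‖θ‖ = 1) (hb : b₂.rOut < 1) : ContDiff ℝ ∞ (rootMap b₂) := by
  refine contDiff_of_contDiffAt_tsupport fun y hy ↦ ?_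
  have hy0 := ne_zero_of_mem_tsupport_bump b₂ hθ hb (tsupport_smul_subset_left _ _ hy)
  have : Real.sqrt ‖y‖ ≠ 0 := by
    have := norm_pos_iff.2 hy0
    positivity
  exact b₂.contDiffAt.smul (((contDiffAt_sqrt_norm hy0).inv this).smul contDiffAt_id)

theorem hasCompactSupport_amplitude : HasCompactSupport (amplitude b) :=
  b.hasCompactSupport.mul_right

theorem hasCompactSupport_rootMap : HasCompactSupport (rootMap b₂) :=
  b₂.hasCompactSupport.smul_right

/-- The function `(2π)⁻ⁿ A(y) Ψ(s (η - y / √|y|))`, where `A` is the amplitude. -/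
def source (Ψ : 𝓢(RSpace n, ℂ)) (s : ℝ) (η y : RSpace n) : ℂ :=
  (((2 * Real.pi) ^ n)⁻¹ * amplitude b y : ℝ) * Ψ (s • (η - rootMap b₂ y))

theorem contDiff_source (hθ : ‖θ‖ = 1) (hb : b.rOut < 1) (hb₂ : b₂.rOut < 1)
    (Ψ : 𝓢(RSpace n, ℂ)) (s : ℝ) (η : RSpace n) : ContDiff ℝ ∞ (source b b₂ Ψ s η) :=
  (Complex.ofRealCLM.contDiff.comp (contDiff_const.mul (contDiff_amplitude b hθ hb))).mul
    ((Ψ.smooth ⊤).comp ((contDiff_const_smul s).comp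
      (contDiff_const.sub (contDiff_rootMap b₂ hθ hb₂))))

theorem hasCompactSupport_source (Ψ : 𝓢(RSpace n, ℂ)) (s : ℝ) (η : RSpace n) :
    HasCompactSupport (source b b₂ Ψ s η) := by
  refine (hasCompactSupport_amplitude b).mono fun y hy ↦ ?_
  intro h0
  exact hy (by simp [source, h0])

theorem source_ne_zero {Ψ : 𝓢(RSpace n, ℂ)} {s : ℝ} {η y : RSpace n}
    (h : source b b₂ Ψ s η y ≠ 0) : ‖y - θ‖ ≤ b.rOut := by
  have : y ∈ Function.support b := fun h0 ↦ h (by simp [source, amplitude, h0])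
  rw [b.support_eq, Metric.mem_ball, dist_eq_norm] at this
  exact this.le

/-- Each derivative falling on the argument of Ψ brings one factor s, by Faà di Bruno; the amplitude
and the root map have bounded derivatives, as they are cut off away from the origin. The bound is
uniform in η because η enters only as a translation. -/
theorem norm_iteratedFDeriv_source_le (hθ : ‖θ‖ = 1) (hb : b.rOut < 1) (hb₂ : b₂.rOut < 1)
    (Ψ : 𝓢(RSpace n, ℂ)) (K : ℕ) : ∃ B, 0 ≤ B ∧ ∀ (s : ℝ) (η : RSpace n), 1 ≤ s →
      ∀ q ≤ K, ∀ y, ‖iteratedFDeriv ℝ q (source b b₂ Ψ s η) y‖ ≤ B * s ^ q := by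
  have hAs : ContDiff ℝ ∞ fun y ↦ ((((2 * Real.pi) ^ n)⁻¹ * amplitude b y : ℝ) : ℂ) :=
    Complex.ofRealCLM.contDiff.comp (contDiff_const.mul (contDiff_amplitude b hθ hb))
  have hAc : HasCompactSupport fun y ↦ ((((2 * Real.pi) ^ n)⁻¹ * amplitude b y : ℝ) : ℂ) :=
    (hasCompactSupport_amplitude b).mono fun y hy h0 ↦ hy (by simp [h0])
  have hωs := contDiff_rootMap b₂ hθ hb₂
  obtain ⟨A, hA1, hA⟩ := exists_bound_iteratedFDeriv hAc hAs K
  obtain ⟨W, hW1, hW⟩ := exists_bound_iteratedFDeriv (hasCompactSupport_rootMap b₂) hωs K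
  let P := ∑ i ∈ Finset.range (K + 1), SchwartzMap.seminorm ℝ 0 i Ψ
  have hP0 : 0 ≤ P := by positivity
  have hP : ∀ i ≤ K, ∀ x, ‖iteratedFDeriv ℝ i Ψ x‖ ≤ P := fun i hi x ↦
    (SchwartzMap.norm_iteratedFDeriv_le_seminorm ℝ Ψ i x).trans
      (Finset.single_le_sum (f := fun i ↦ SchwartzMap.seminorm ℝ 0 i Ψ)
        (fun _ _ ↦ apply_nonneg _ _) (Finset.mem_range_succ_iff.2 hi))
  refine ⟨2 ^ K * A * (K.factorial * P * W ^ K), by positivity, fun s η hs1 q hq y ↦ ?_⟩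
  have hs0 : 0 < s := by linarith
  have hfs : ContDiff ℝ ∞ fun y ↦ s • (η - rootMap b₂ y) :=
    (contDiff_const_smul s).comp (contDiff_const.sub hωs)
  have hD : ∀ i, 1 ≤ i → i ≤ K → ∀ y,
      ‖iteratedFDeriv ℝ i (fun y ↦ s • (η - rootMap b₂ y)) y‖ ≤ (s * W) ^ i := by
    intro i hi1 hi y
    have h1 : iteratedFDeriv ℝ i (fun y ↦ s • (η - rootMap b₂ y)) y =
        s • (iteratedFDeriv ℝ i (fun _ ↦ η) y - iteratedFDeriv ℝ i (rootMap b₂) y) := by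
      have h2 := iteratedFDeriv_const_smul_apply (𝕜 := ℝ) (i := i) (x := y) (a := s)
        (f := fun y ↦ η - rootMap b₂ y)
        ((contDiff_const.sub hωs).of_le (by exact_mod_cast le_top)).contDiffAt
      have h3 := iteratedFDeriv_sub_apply (𝕜 := ℝ) (i := i) (x := y) (f := fun _ ↦ η)
        (g := rootMap b₂) contDiff_const.contDiffAt
        (hωs.of_le (by exact_mod_cast le_top)).contDiffAt
      rw [← h3]
      exact h2
    rw [h1, iteratedFDeriv_const_of_ne (by omega), Pi.zero_apply, zero_sub, norm_smul, norm_neg,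
      Real.norm_of_nonneg hs0.le]
    calc _ ≤ s * W := by gcongr; exact hW i hi y
      _ ≤ (s * W) ^ i := le_self_pow₀ (one_le_mul_of_one_le_of_one_le hs1 hW1) (by omega)
  have hcomp : ∀ i ≤ q, ‖iteratedFDeriv ℝ i (fun y ↦ Ψ (s • (η - rootMap b₂ y))) y‖ ≤
      K.factorial * P * W ^ K * s ^ q := by
    intro i hi
    have hiK := hi.trans hq
    have := norm_iteratedFDeriv_comp_le (Ψ.smooth ⊤) hfs (n := i) (by exact_mod_cast le_top) y
      (C := P) (D := s * W) (fun j hj ↦ hP j (hj.trans hiK) _)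
      (fun j hj1 hj ↦ hD j hj1 (hj.trans hiK) y)
    calc _ ≤ (i.factorial : ℝ) * P * (s * W) ^ i := this
      _ = i.factorial * P * W ^ i * s ^ i := by rw [mul_pow]; ring
      _ ≤ _ := by gcongr
  have := norm_iteratedFDeriv_mul_le_of_le hAs ((Ψ.smooth ⊤).comp hfs) y q
    (fun i hi ↦ hA i (hi.trans hq) y) hcomp
  calc _ ≤ _ := this
    _ ≤ 2 ^ K * A * (K.factorial * P * W ^ K * s ^ q) := by gcongr; norm_num
    _ = _ := by ring

/-- The source as a Schwartz function. -/
def schwartzSource (hθ : ‖θ‖ = 1) (hb : b.rOut < 1) (hb₂ : b₂.rOut < 1)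
    (Ψ : 𝓢(RSpace n, ℂ)) (s : ℝ) (η : RSpace n) : 𝓢(RSpace n, ℂ) :=
  (hasCompactSupport_source b b₂ Ψ s η).toSchwartzMap (contDiff_source b b₂ hθ hb hb₂ Ψ s η)

/-- With v = -w/s, the double Fourier transform reflects |w|w, and the scaling takes it to y = |v|v,
whose root is v; hence the argument s(η - v) = w + sη. The amplitude and the factors s⁻ⁿ and (2π)⁻ⁿ
cancel the Jacobian 2|w|ⁿ = 2sⁿ|v|ⁿ and the (2π)ⁿ of Fourier inversion. -/
theorem transposeRescale_source (hθ : ‖θ‖ = 1) (hb : b.rOut ≤ 1 / 8) (hb₂ : b₂.rOut < 1)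
    (hbb : b.rOut ≤ b₂.rIn) (Ψ : 𝓢(RSpace n, ℂ)) {s : ℝ} (hs0 : 0 < s) (hs : 5 ≤ s)
    (η w : RSpace n) :
    transposeRescale n (schwartzFourier n (schwartzFourier n (parabolicScale n hs0
      (schwartzSource b b₂ hθ (by linarith) hb₂ Ψ s η)))) w =
    b (‖-s⁻¹ • w‖ • (-s⁻¹ • w)) * Ψ (w + s • η) := by
  set v := -s⁻¹ • w with hv
  have hw : w = -s • v := by rw [hv, smul_smul, neg_mul_neg, mul_inv_cancel₀ hs0.ne', one_smul]
  have hnw : ‖w‖ = s * ‖v‖ := by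
    rw [hw, norm_smul, norm_neg, Real.norm_of_nonneg hs0.le]
  have hpt : (s ^ 2)⁻¹ • -(‖w‖ • w) = ‖v‖ • v := by
    rw [hnw, ← smul_neg]
    nth_rewrite 1 [hw]
    rw [neg_smul, neg_neg, smul_smul, smul_smul]
    congr 1
    field_simp
  rw [transposeRescale_apply, schwartzFourier_schwartzFourier, parabolicScale_apply, hpt]
  change _ * (_ * (_ * source b b₂ Ψ s η (‖v‖ • v))) = _
  rcases eq_or_ne (b (‖v‖ • v)) 0 with h0 | h0
  · simp [source, amplitude, h0]
  have hmem : ‖‖v‖ • v - θ‖ < b.rOut := by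
    have : ‖v‖ • v ∈ Function.support b := h0
    rwa [b.support_eq, Metric.mem_ball, dist_eq_norm] at this
  have hv2 : ‖‖v‖ • v‖ = ‖v‖ ^ 2 := by rw [norm_smul, norm_norm, sq]
  have hvlow : 7 / 8 ≤ ‖v‖ ^ 2 := by
    have := norm_sub_norm_le θ (‖v‖ • v)
    rw [norm_sub_rev, hv2, hθ] at this
    linarith
  have hv1 : 3 / 5 ≤ ‖v‖ := by
    by_contra! h
    nlinarith [norm_nonneg v]
  have hv0 : ‖v‖ ≠ 0 := by linarith
  -- This is where s ≥ 5 is used: |w| = s|v| ≥ 5 · 3/5 = 3.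
  have hcut : cutoff w = 1 := cutoff_eq_one (by rw [hnw]; nlinarith)
  have hsq : Real.sqrt ‖‖v‖ • v‖ = ‖v‖ := by rw [hv2, Real.sqrt_sq (norm_nonneg v)]
  have hb1 : b₂ (‖v‖ • v) = 1 := b₂.one_of_mem_closedBall (by
    rw [Metric.mem_closedBall, dist_eq_norm]; linarith)
  have hroot : rootMap b₂ (‖v‖ • v) = v := by
    rw [rootMap, hsq, hb1, one_smul, inv_smul_smul₀ hv0]
  have harg : s • (η - v) = w + s • η := by
    rw [hw, smul_sub, neg_smul]; abel
  rw [source, hroot, harg, amplitude, hsq, hcut, hnw]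
  have hpi : (Real.pi : ℂ) ≠ 0 := by exact_mod_cast Real.pi_ne_zero
  have hsc : (s : ℂ) ≠ 0 := by exact_mod_cast hs0.ne'
  have hvc : (‖v‖ : ℂ) ≠ 0 := by exact_mod_cast hv0
  push_cast
  rw [mul_pow]
  field_simp

end Source

/-! ### The part of the packet away from the direction θ -/

section Remainder

variable {θ : RSpace n}

/-- The map v ↦ |v|v is smooth off the origin, and the support of b stays away from the origin. -/
theorem contDiff_bump_norm_smul (b : ContDiffBump θ) (hθ : ‖θ‖ = 1) (hb : b.rOut < 1) :
    ContDiff ℝ ∞ fun v : RSpace n ↦ (b (‖v‖ • v) : ℂ) := by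
  refine contDiff_of_contDiffAt_tsupport fun v hv ↦ ?_
  have hcont : Continuous fun v : RSpace n ↦ ‖v‖ • v := continuous_norm.smul continuous_id
  have hv1 : ‖v‖ • v ∈ tsupport b := by
    have hsub : tsupport (fun v : RSpace n ↦ (b (‖v‖ • v) : ℂ)) ⊆
        (fun v : RSpace n ↦ ‖v‖ • v) ⁻¹' tsupport b := by
      refine closure_minimal (fun x hx ↦ subset_tsupport _ fun h0 ↦ hx ?_)
        ((isClosed_tsupport _).preimage hcont)
      simp [h0]
    exact hsub hv
  have hv0 : v ≠ 0 := by
    rintro rfl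
    exact ne_zero_of_mem_tsupport_bump b hθ hb hv1 (by simp)
  exact Complex.ofRealCLM.contDiff.contDiffAt.comp v
    (b.contDiff.contDiffAt.comp v ((contDiffAt_norm ℝ hv0).smul contDiffAt_id))

theorem hasCompactSupport_bump_norm_smul (b : ContDiffBump θ) :
    HasCompactSupport fun v : RSpace n ↦ (b (‖v‖ • v) : ℂ) := by
  refine HasCompactSupport.of_support_subset_isCompact
    (isCompact_closedBall (0 : RSpace n) (1 + (‖θ‖ + b.rOut))) fun v hv ↦ ?_
  have h0 : ‖v‖ • v ∈ Function.support b := fun h0 ↦ hv (by simp [h0])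
  rw [b.support_eq, Metric.mem_ball, dist_eq_norm] at h0
  have h1 := norm_sub_norm_le (‖v‖ • v) θ
  rw [norm_smul, norm_norm] at h1
  rw [mem_closedBall_zero_iff]
  nlinarith [norm_nonneg v, sq_nonneg (‖v‖ - 1), norm_nonneg θ, b.rOut_pos]

theorem exists_bump_norm_smul_eq_one (b : ContDiffBump θ) (hθ : ‖θ‖ = 1) :
    ∃ δ, 0 < δ ∧ ∀ v, ‖v - θ‖ < δ → b (‖v‖ • v) = 1 := by
  have hcont : Continuous fun v : RSpace n ↦ ‖v‖ • v := continuous_norm.smul continuous_id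
  have hmem : Metric.ball θ b.rIn ∈ 𝓝 (‖θ‖ • θ) := by
    rw [hθ, one_smul]
    exact Metric.ball_mem_nhds _ b.rIn_pos
  obtain ⟨δ, hδ, hsub⟩ := Metric.mem_nhds_iff.1 (hcont.continuousAt.preimage_mem_nhds hmem)
  refine ⟨δ, hδ, fun v hv ↦ b.one_of_mem_closedBall (Metric.ball_subset_closedBall (hsub ?_))⟩
  rwa [Metric.mem_ball, dist_eq_norm]

/-- Away from the direction `θ`, the translates `Ψ(w + s η)`, for `η` near `θ`, are rapidly
decreasing in `s`. -/
theorem exists_norm_apply_translate_le (T : 𝓢'(RSpace n, ℂ)) {a : RSpace n → ℂ}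
    (hc : HasCompactSupport a) (hs : ContDiff ℝ ∞ a) {δ : ℝ} (hδ : 0 < δ)
    (ha : ∀ v, ‖v - θ‖ < δ → a v = 1) (Ψ : 𝓢(RSpace n, ℂ)) (N : ℕ) :
    ∃ C, 0 ≤ C ∧ ∀ (s : ℝ) (η : RSpace n) (f : 𝓢(RSpace n, ℂ)), 1 ≤ s → ‖η‖ = 1 →
      ‖η - θ‖ < δ / 2 → (∀ w, f w = (1 - a (-s⁻¹ • w)) * Ψ (w + s • η)) →
      s ^ N * ‖T f‖ ≤ C := by
  obtain ⟨S, C₀, hC₀, hT⟩ := norm_temperedDistribution_le T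
  let M := S.sup Prod.fst + S.sup Prod.snd
  have hM : ∀ i ∈ S, i.1 ≤ M ∧ i.2 ≤ M := fun i hi ↦
    ⟨(Finset.le_sup (f := Prod.fst) hi).trans (Nat.le_add_right _ _),
      (Finset.le_sup (f := Prod.snd) hi).trans (Nat.le_add_left _ _)⟩
  obtain ⟨A, hA1, hA⟩ := exists_bound_iteratedFDeriv hc hs M
  let P := 2 ^ (M + N) * (Finset.Iic (M + N, M)).sup
    (fun m ↦ SchwartzMap.seminorm ℝ m.1 m.2) Ψ
  have hP : ∀ j ≤ M, ∀ x, (1 + ‖x‖) ^ (M + N) * ‖iteratedFDeriv ℝ j Ψ x‖ ≤ P := fun j hj x ↦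
    SchwartzMap.one_add_le_sup_seminorm_apply (𝕜 := ℝ) (m := (M + N, M)) le_rfl hj Ψ x
  have hP0 : 0 ≤ P := (by positivity : (0 : ℝ) ≤ _).trans (hP 0 (Nat.zero_le _) 0)
  -- Where 1 - a ≠ 0, -w/s is at least δ/2 away from η, so s ≤ (2/δ)|w + sη|. Then both s and |w|
  -- are at most Q(1 + |w + sη|), and decay of Ψ of order M + N absorbs the weights and s^N.
  let Q := 1 + 2 / δ
  have hQ1 : 1 ≤ Q := le_add_of_nonneg_right (by positivity)
  refine ⟨C₀ * (2 ^ M * (1 + A) * (Q ^ (M + N) * P)), by positivity, fun s η f hs1 hη hηθ hf ↦ ?_⟩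
  have hs0 : 0 < s := by linarith
  have hfun : (f : RSpace n → ℂ) = fun w ↦ (1 - a (-s⁻¹ • w)) * Ψ (w + s • η) := funext hf
  rw [← le_div_iff₀' (by positivity)]
  refine (hT f (2 ^ M * (1 + A) * (Q ^ (M + N) * P) / s ^ N) (by positivity)
    fun i hi w ↦ ?_).trans_eq (by ring)
  obtain ⟨hk, hl⟩ := hM i hi
  have hlin : Continuous fun w : RSpace n ↦ ‖-s⁻¹ • w - θ‖ := by fun_prop
  rcases lt_or_ge ‖-s⁻¹ • w - θ‖ δ with hw | hw
  · have : (f : RSpace n → ℂ) =ᶠ[𝓝 w] fun _ ↦ 0 := by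
      filter_upwards [(isOpen_lt hlin continuous_const).mem_nhds hw] with y hy
      rw [hf, ha _ hy, sub_self, zero_mul]
    rw [(this.iteratedFDeriv ℝ i.2).eq_of_nhds]
    simp only [iteratedFDeriv_fun_zero, Pi.zero_apply, norm_zero, mul_zero]
    positivity
  · have has : ContDiff ℝ ∞ fun w ↦ a (-s⁻¹ • w) := hs.comp (contDiff_const_smul (-s⁻¹))
    have haD : ∀ j ≤ i.2, ‖iteratedFDeriv ℝ j (fun w ↦ 1 - a (-s⁻¹ • w)) w‖ ≤ 1 + A := by
      intro j hj
      refine (norm_iteratedFDeriv_one_sub_le has j w).trans (add_le_add_right ?_ 1)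
      rw [iteratedFDeriv_comp_const_smul _ (hs.of_le (by exact_mod_cast le_top)), norm_smul,
        norm_pow, norm_neg, norm_inv, Real.norm_of_nonneg hs0.le]
      calc _ ≤ 1 * A := by
            gcongr
            · exact pow_le_one₀ (by positivity) (inv_le_one_of_one_le₀ hs1)
            · exact hA j (hj.trans hl) _
        _ = A := one_mul A
    have hΨs : ContDiff ℝ ∞ fun w ↦ Ψ (w + s • η) :=
      (Ψ.smooth ⊤).comp (contDiff_id.add contDiff_const)
    have hlow : s ≤ 2 / δ * ‖w + s • η‖ := by
      have h1 : ‖-s⁻¹ • w - θ‖ ≤ ‖-s⁻¹ • w - η‖ + ‖η - θ‖ := norm_sub_le_norm_sub_add_norm_sub _ _ _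
      have h2 : ‖-s⁻¹ • w - η‖ = s⁻¹ * ‖w + s • η‖ := by
        have : -s⁻¹ • w - η = -s⁻¹ • (w + s • η) := by
          rw [smul_add, smul_smul, neg_mul, inv_mul_cancel₀ hs0.ne', neg_one_smul, sub_eq_add_neg]
        rw [this, norm_smul, norm_neg, norm_inv, Real.norm_of_nonneg hs0.le]
      have h3 : δ / 2 ≤ s⁻¹ * ‖w + s • η‖ := by linarith
      rw [inv_mul_eq_div, le_div_iff₀ hs0] at h3
      rw [div_mul_eq_mul_div, le_div_iff₀ hδ]
      linarith
    have hbase : s ≤ Q * (1 + ‖w + s • η‖) := by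
      have : 0 ≤ 2 / δ := by positivity
      simp only [Q]
      nlinarith [norm_nonneg (w + s • η)]
    have hwn : ‖w‖ ≤ Q * (1 + ‖w + s • η‖) := by
      have h1 : ‖w‖ ≤ ‖w + s • η‖ + s := by
        have := norm_sub_le (w + s • η) (s • η)
        rwa [add_sub_cancel_right, norm_smul, hη, mul_one, Real.norm_of_nonneg hs0.le] at this
      have : 0 ≤ 2 / δ := by positivity
      simp only [Q]
      nlinarith [norm_nonneg (w + s • η)]
    have hone : 1 ≤ Q * (1 + ‖w + s • η‖) :=
      one_le_mul_of_one_le_of_one_le hQ1 (by linarith [norm_nonneg (w + s • η)])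
    have hΨD : ∀ j ≤ i.2, ‖w‖ ^ i.1 * ‖iteratedFDeriv ℝ j (fun w ↦ Ψ (w + s • η)) w‖ ≤
        Q ^ (M + N) * P / s ^ N := by
      intro j hj
      rw [iteratedFDeriv_comp_add_right, le_div_iff₀ (by positivity)]
      calc ‖w‖ ^ i.1 * ‖iteratedFDeriv ℝ j Ψ (w + s • η)‖ * s ^ N
          ≤ (Q * (1 + ‖w + s • η‖)) ^ i.1 * ‖iteratedFDeriv ℝ j Ψ (w + s • η)‖ *
            (Q * (1 + ‖w + s • η‖)) ^ N := by gcongr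
        _ ≤ (Q * (1 + ‖w + s • η‖)) ^ M * ‖iteratedFDeriv ℝ j Ψ (w + s • η)‖ *
            (Q * (1 + ‖w + s • η‖)) ^ N := by gcongr
        _ = Q ^ (M + N) * ((1 + ‖w + s • η‖) ^ (M + N) *
            ‖iteratedFDeriv ℝ j Ψ (w + s • η)‖) := by rw [mul_pow, mul_pow]; ring
        _ ≤ _ := by gcongr; exact hP j (hj.trans hl) _
    have := pow_mul_norm_iteratedFDeriv_mul_le (contDiff_const.sub has) hΨs w i.1 i.2 haD hΨD
    rw [hfun]
    calc _ ≤ _ := this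
      _ ≤ 2 ^ M * (1 + A) * (Q ^ (M + N) * P / s ^ N) := by
        gcongr
        norm_num
      _ = _ := by ring

end Remainder

/-! ### Assembling the proof -/

theorem schwartzFourier_modulate {ψ : RSpace n → ℂ} (hc : HasCompactSupport ψ)
    (hs : ContDiff ℝ ∞ ψ) (η w : RSpace n) :
    schwartzFourier n (modulate ψ hc hs η) w =
      schwartzFourier n (hc.toSchwartzMap hs) (w + η) := by
  rw [schwartzFourier_apply, schwartzFourier_apply]
  congr 1
  funext x
  change planeWave w x * (planeWave η x * ψ x) = planeWave (w + η) x * ψ x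
  rw [planeWave_add, mul_assoc]

/-- If `ũ` is microlocally smooth at frequency `0` in the direction `θ`, then `F u` is microlocally
smooth in the direction `θ` at every point. -/
theorem IsMicrolocallySmoothAt.of_rescale {u : 𝓢'(RSpace n, ℂ)} {θ : USphere n}
    (h : IsMicrolocallySmoothAt (distFourier (rescale u)) 0 θ) (ξ : RSpace n) :
    IsMicrolocallySmoothAt (distFourier u) ξ θ := by
  have hθ : ‖(θ : RSpace n)‖ = 1 := mem_sphere_zero_iff_norm.1 θ.2
  obtain ⟨ε, hε, hε1, hmain⟩ := h.norm_apply_parabolicScale_le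
  -- The outer radius ε/8 is the support condition required by `hmain`, and it equals the inner
  -- radius of `b₂`, so the cut-off root map is exact on the support of `b`.
  let b : ContDiffBump (θ : RSpace n) := ⟨ε / 16, ε / 8, by positivity, by linarith⟩
  let b₂ : ContDiffBump (θ : RSpace n) := ⟨ε / 8, ε / 4, by positivity, by linarith⟩
  have hb8 : b.rOut ≤ 1 / 8 := by change ε / 8 ≤ 1 / 8; linarith
  have hb : b.rOut < 1 := by linarith
  have hb₂ : b₂.rOut < 1 := by change ε / 4 < 1; linarith
  let β : ContDiffBump ξ := ⟨1, 2, by norm_num, by norm_num⟩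
  let ψ : RSpace n → ℂ := fun x ↦ (β x : ℂ)
  have hψs : ContDiff ℝ ∞ ψ := Complex.ofRealCLM.contDiff.comp β.contDiff
  have hψc : HasCompactSupport ψ := β.hasCompactSupport.comp_left (g := Complex.ofReal) (by simp)
  let Ψ := schwartzFourier n (hψc.toSchwartzMap hψs)
  let a : RSpace n → ℂ := fun v ↦ (b (‖v‖ • v) : ℂ)
  have has : ContDiff ℝ ∞ a := contDiff_bump_norm_smul b hθ hb
  have hac : HasCompactSupport a := hasCompactSupport_bump_norm_smul b
  obtain ⟨δ, hδ, hδ1⟩ := exists_bump_norm_smul_eq_one b hθ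
  have ha1 : ∀ v, ‖v - (θ : RSpace n)‖ < δ → a v = 1 := fun v hv ↦ by simp [a, hδ1 v hv]
  obtain ⟨M, D, hD0, hD⟩ := norm_apply_modulate_le hψc hψs (distFourier u)
  refine ⟨ψ, hψc, hψs, ?_, Metric.ball θ (δ / 2), Metric.ball_mem_nhds _ (by positivity),
    fun N ↦ ?_⟩
  · have : β ξ = 1 := β.one_of_mem_closedBall (by simp [β])
    simp [ψ, this]
  obtain ⟨K, C₁, hC₁, h₁⟩ := hmain N
  obtain ⟨B, hB0, hB⟩ := norm_iteratedFDeriv_source_le b b₂ hθ hb hb₂ Ψ K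
  obtain ⟨C₂, hC₂, h₂⟩ := exists_norm_apply_translate_le (θ := (θ : RSpace n)) u hac has hδ ha1 Ψ N
  refine ⟨6 ^ N * (D * 6 ^ M) + 2 ^ N * (C₁ * B + C₂), fun θ' hθ' s hs0 ↦ ?_⟩
  have hθ'1 : ‖(θ' : RSpace n)‖ = 1 := mem_sphere_zero_iff_norm.1 θ'.2
  have hθ'δ : ‖(θ' : RSpace n) - θ‖ < δ / 2 := by
    rw [← dist_eq_norm]
    exact hθ'
  rw [le_div_iff₀ (by positivity), mul_comm]
  -- Below 5 the polynomial bound already gives a constant, as 1 + s ≤ 6; from 5 on, the cutoff in ũ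
  -- is 1 on the packet and 1 + s ≤ 2s.
  rcases lt_or_ge s 5 with hs5 | hs5
  · have hnorm : ‖s • (θ' : RSpace n)‖ = s := by
      rw [norm_smul, hθ'1, mul_one, Real.norm_of_nonneg hs0.le]
    calc _ ≤ 6 ^ N * (D * (1 + ‖s • (θ' : RSpace n)‖) ^ M) := by
          gcongr
          · linarith
          · exact hD _
      _ ≤ 6 ^ N * (D * 6 ^ M) := by
          gcongr
          rw [hnorm]
          linarith
      _ ≤ _ := le_add_of_nonneg_right (by positivity)
  · have hs1 : 1 ≤ s := by linarith
    let f := schwartzFourier n (modulate ψ hψc hψs (s • (θ' : RSpace n)))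
    let g := schwartzFourier n (parabolicScale n hs0
      (schwartzSource b b₂ hθ hb hb₂ Ψ s (θ' : RSpace n)))
    let R := f - transposeRescale n (schwartzFourier n g)
    have e1 : s ^ N * ‖distFourier (rescale u) g‖ ≤ C₁ * B :=
      h₁ s B _ hs0 hs1 hB0 (fun y hy ↦ source_ne_zero b b₂ hy) (hB s θ' hs1)
    have e2 : s ^ N * ‖u R‖ ≤ C₂ := h₂ s θ' R hs1 hθ'1 hθ'δ fun w ↦ by
      simp only [R, f, g, sub_apply]
      rw [schwartzFourier_modulate,
        transposeRescale_source b b₂ hθ hb8 hb₂ (le_refl (ε / 8)) Ψ hs0 hs5]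
      simp only [Ψ, a]
      ring
    -- By duality, u on the transposed rescaling of F g is F ũ on g.
    have e3 : distFourier u (modulate ψ hψc hψs (s • (θ' : RSpace n))) =
        u R + distFourier (rescale u) g := by
      change u f = u (f - _) + u (transposeRescale n (schwartzFourier n g))
      rw [← map_add, sub_add_cancel]
    calc _ ≤ (2 * s) ^ N * ‖u R + distFourier (rescale u) g‖ := by
          rw [e3]
          gcongr
          linarith
      _ ≤ (2 * s) ^ N * (‖u R‖ + ‖distFourier (rescale u) g‖) := by
          gcongr
          exact norm_add_le _ _
      _ = 2 ^ N * (s ^ N * ‖distFourier (rescale u) g‖ + s ^ N * ‖u R‖) := by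
          rw [mul_pow]; ring
      _ ≤ 2 ^ N * (C₁ * B + C₂) := by gcongr
      _ ≤ _ := le_add_of_nonneg_left (by positivity)

end ScatteringWF

end

theorem mainTheorem6 (n : ℕ) (u : 𝓢'(ScatteringWF.RSpace n, ℂ)) (θ : ScatteringWF.USphere n)
    (hθ : (θ, (0 : ScatteringWF.RSpace n)) ∉ ScatteringWF.WFqsc u)
    (ξ : ScatteringWF.RSpace n) :
    (θ, ξ) ∉ ScatteringWF.WFsc u :=
  not_not.2 ((not_not.1 hθ).of_rescale ξ)
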